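/- Let $(a_n)_{n\ge1}$ be a lacunary sequence of positive real numbers, that is, $a_n>0$ for all $n\ge1$ and there is a constant $c>1$ such that $a_{n+1}\ge c\,a_n$ for all $n\ge1$. Then for Lebesgue-almost every $\alpha\in\mathbb{R}$, the $k$-level correlation of the sequence $(\alpha a_n)_{n\ge1}$ modulo $1$ is Poissonian for every integer $k\ge2$; that is, for almost every $\alpha$, for every $k\ge2$ and every compactly supported smooth function $f:\mathbb{R}^{k-1}\to\mathbb{R}$, $$\lim_{N\to\infty}\frac1N\sum_{m\in\mathbb{Z}^{k-1}}\ \sum_{\substack{1\le x_1,\dots,x_k\le N\\ x_1,\dots,x_k\text{ distinct}}} f\bigl(N(\Delta_\alpha(x)-m)\bigr)=\int_{\mathbb{R}^{k-1}}f(y)\,dy,$$ where $\Delta_\alpha(x)=\bigl(\alpha a_{x_1}-\alpha a_{x_2},\ \alpha a_{x_2}-\alpha a_{x_3},\ \dots,\ \alpha a_{x_{k-1}}-\alpha a_{x_k}\bigr)$. -/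

import Mathlib

open scoped ContDiff

/-- A real sequence `a 1, a 2, …` is lacunary if `a (n + 1) ≥ c * a n` for all `n ≥ 1`, for some
constant `c > 1`. Sequences are indexed by `n ≥ 1`; the value `a 0` plays no role anywhere. -/
def IsLacunary (a : ℕ → ℝ) : Prop :=
  ∃ c : ℝ, 1 < c ∧ ∀ n : ℕ, 1 ≤ n → c * a n ≤ a (n + 1)

/-- The vector `(a_{x_1} - a_{x_2}, a_{x_2} - a_{x_3}, …, a_{x_{k-1}} - a_{x_k})`. -/
def consecutiveDiff {k : ℕ} (a : ℕ → ℝ) (x : Fin k → ℕ) (i : Fin (k - 1)) : ℝ :=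
  a (x ⟨i, by have := i.isLt; omega⟩) - a (x ⟨i + 1, by have := i.isLt; omega⟩)

/-- The tuples `(x_1, …, x_k)` of pairwise distinct integers with `1 ≤ x_1, …, x_k ≤ N`. -/
def distinctTuples (k N : ℕ) : Finset (Fin k → ℕ) :=
  (Fintype.piFinset fun _ : Fin k => Finset.Icc 1 N).filter fun x => Function.Injective x

/-- The `k`-level correlation sum
`R_k(f, (a_n), N) = (1 / N) ∑_{m ∈ ℤ^{k-1}} ∑_x f (N (Δ(x) - m))`, where `x` runs over the
`k`-tuples of distinct elements of `{1, …, N}`. For compactly supported `f` only finitely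
many `m` contribute. -/
noncomputable def correlationSum (k : ℕ) (f : (Fin (k - 1) → ℝ) → ℝ) (a : ℕ → ℝ) (N : ℕ) : ℝ :=
  (1 / (N : ℝ)) * ∑' m : Fin (k - 1) → ℤ, ∑ x ∈ distinctTuples k N,
    f (fun i => (N : ℝ) * (consecutiveDiff a x i - (m i : ℝ)))

/-- The `k`-level correlation of `(a_n)` mod 1 is Poissonian: for every smooth compactly supported
`f : ℝ^{k-1} → ℝ` the correlation sums converge to `∫ f`. -/
def HasPoissonianCorrelation (k : ℕ) (a : ℕ → ℝ) : Prop :=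
  ∀ f : (Fin (k - 1) → ℝ) → ℝ, ContDiff ℝ ∞ f → HasCompactSupport f →
    Filter.Tendsto (fun N : ℕ => correlationSum k f a N) Filter.atTop
      (nhds (∫ y : Fin (k - 1) → ℝ, f y))

/-! Points α·a_y with widely spaced indices behave like independent uniform points of the circle. If
the indices exceed L and are pairwise at least L apart, lacunarity makes the frequencies, and the
ratios between them, at least Q = L^m for any fixed m once L is large. A line with such a direction
averages a Λ-Lipschitz function bounded by B on the torus to its mean, up to O((B + Λ)/Q)
(`abs_integral_sub_cube_le_fin`). With N = L^D, any fixed power of N is still a power of L, so Q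
absorbs every loss polynomial in N, while only a proportion O(L/N) of all tuples fails to be
separated.

The test functions are products of hats `tent (M * y i - v i)`. Periodized at scale N they become
Lipschitz functions on the torus with constant O(NM), and their torus mean is exactly the expected
weight of one tuple. Separated tuples are treated by a second moment
(`exists_integral_sq_separated_le`): jointly separated pairs of tuples are essentially uncorrelated.
The other pairs contribute little because the number of points α·a_y in an arc of length O(1/N) has
all its moments bounded up to powers of L (`exists_sum_card_ball_pow_le`). Distinct but
non-separated tuples are treated by a first moment (`exists_integral_crowded_le`): two distinct
indices beyond L have a_{z'} - a_z ≥ Q, so their points are rarely 1/N-close.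

After division by N both contributions are O(L^(-2)) along N = L^D, which is summable, so
`ae_tendsto_sparse_tupleWeight` follows by Borel–Cantelli. The parameters (n, M, v) are countable,
so one null set suffices. What remains is deterministic: hats form partitions of unity and so
approximate every continuous compactly supported function (`tendsto_corrMass_of_tentProd`), and the
correlation sum at N is sandwiched between those at L^D and (L+1)^D, whose ratio tends to 1
(`tendsto_corrMass_of_sparse`). -/

open scoped ContDiff
open MeasureTheory

/-! ### Averaging on the torus along rapidly growing frequencies -/

/-- The uniform probability measure on the unit cube. -/
noncomputable def cubeMeasure (ι : Type*) [Fintype ι] : Measure (ι → ℝ) :=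
  Measure.pi fun _ => volume.restrict (Set.Ioc (0 : ℝ) 1)

instance isProbabilityMeasure_restrict_Ioc_zero_one :
    IsProbabilityMeasure (volume.restrict (Set.Ioc (0 : ℝ) 1)) :=
  ⟨by simp⟩

instance isProbabilityMeasure_cubeMeasure (ι : Type*) [Fintype ι] :
    IsProbabilityMeasure (cubeMeasure ι) := by
  unfold cubeMeasure; infer_instance

/-- `ℤ^ι`-periodic functions on `ℝ^ι` that are bounded by `B` and `Λ`-Lipschitz. -/
structure TorusLipschitz {ι : Type*} [Fintype ι] (H : (ι → ℝ) → ℝ) (B Λ : ℝ) : Prop where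
  bound : ∀ θ, |H θ| ≤ B
  lip : ∀ θ θ', |H θ - H θ'| ≤ Λ * ‖θ - θ'‖
  per : ∀ (θ : ι → ℝ) (m : ι → ℤ), H (fun i => θ i + m i) = H θ

namespace TorusLipschitz

variable {ι : Type*} [Fintype ι] {H : (ι → ℝ) → ℝ} {B Λ : ℝ}

lemma continuous (h : TorusLipschitz H B Λ) : Continuous H := by
  have : LipschitzWith (Real.toNNReal Λ) H := by
    refine LipschitzWith.of_dist_le_mul fun x y => ?_
    rw [Real.dist_eq, dist_eq_norm]
    exact (h.lip x y).trans (mul_le_mul_of_nonneg_right (Real.le_coe_toNNReal Λ) (norm_nonneg _))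
  exact this.continuous

lemma bound_nonneg (h : TorusLipschitz H B Λ) : 0 ≤ B := (abs_nonneg _).trans (h.bound 0)

end TorusLipschitz

lemma abs_intervalIntegral_unit_le {f : ℝ → ℝ} {C : ℝ} (T : ℝ) (h : ∀ x, |f x| ≤ C) :
    |∫ x in T..T + 1, f x| ≤ C := by
  have := intervalIntegral.norm_integral_le_of_norm_le_const (f := f) (a := T) (b := T + 1)
    (C := C) (fun x _ => h x)
  simpa using this

lemma abs_intervalIntegral_unit_sub_le {f g : ℝ → ℝ} {C : ℝ} (T : ℝ) (hf : Continuous f)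
    (hg : Continuous g) (h : ∀ x, |f x - g x| ≤ C) :
    |(∫ x in T..T + 1, f x) - ∫ x in T..T + 1, g x| ≤ C := by
  rw [← intervalIntegral.integral_sub (hf.intervalIntegrable _ _) (hg.intervalIntegrable _ _)]
  exact abs_intervalIntegral_unit_le T h

lemma abs_integral_shift_sub_le {g : ℝ → ℝ} {B : ℝ} (hg : Continuous g) (hB : ∀ x, |g x| ≤ B)
    (T s : ℝ) (hs : 0 ≤ s) :
    |(∫ x in T..T + 1, g (x + s)) - ∫ x in T..T + 1, g x| ≤ 2 * B * s := by
  have hi : ∀ a b, IntervalIntegrable g volume a b := fun a b => hg.intervalIntegrable a b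
  rw [intervalIntegral.integral_comp_add_right]
  have e : (∫ x in T + s..T + 1 + s, g x) - ∫ x in T..T + 1, g x
      = (∫ x in T + 1..T + 1 + s, g x) - ∫ x in T..T + s, g x := by
    rw [← intervalIntegral.integral_add_adjacent_intervals (hi (T + s) (T + 1))
      (hi (T + 1) (T + 1 + s)),
      ← intervalIntegral.integral_add_adjacent_intervals (hi T (T + s)) (hi (T + s) (T + 1))]
    ring
  rw [e]
  have h1 := intervalIntegral.norm_integral_le_of_norm_le_const (f := g) (a := T + 1)
    (b := T + 1 + s) (C := B) (fun x _ => hB x)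
  have h2 := intervalIntegral.norm_integral_le_of_norm_le_const (f := g) (a := T)
    (b := T + s) (C := B) (fun x _ => hB x)
  simp only [add_sub_cancel_left, abs_of_nonneg hs, Real.norm_eq_abs] at h1 h2
  calc _ ≤ _ := abs_sub _ _
    _ ≤ 2 * B * s := by linarith

/-- If `h` is slowly varying in its first and `1`-periodic in its second variable, then along
`θ = α A` with `A` large the second variable may be averaged out. -/
lemma abs_integral_sub_average_le {h : ℝ → ℝ → ℝ} {B Λ A : ℝ}
    (hc : Continuous fun p : ℝ × ℝ => h p.1 p.2) (hB : ∀ x y, |h x y| ≤ B)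
    (hL : ∀ x x' y, |h x y - h x' y| ≤ Λ * |x - x'|) (hp : ∀ x y, h x (y + 1) = h x y)
    (hA : 0 < A) (T : ℝ) :
    |(∫ x in T..T + 1, h x (x * A)) - ∫ x in T..T + 1, ∫ y in (0 : ℝ)..1, h x y|
      ≤ (2 * B + Λ) / A := by
  have hc2 : ∀ {X : Type} [TopologicalSpace X] {f g : X → ℝ}, Continuous f → Continuous g →
      Continuous fun t => h (f t) (g t) := fun hf hg => hc.comp (hf.prodMk hg)
  have hB0 : 0 ≤ B := (abs_nonneg _).trans (hB 0 0)
  have hL0 : 0 ≤ Λ := by have := (abs_nonneg _).trans (hL 1 0 0); simpa using this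
  -- Adding a phase u to the fast variable amounts to translating x by u/A. The slow variable then
  -- moves by u/A, costing Λu/A, and so does the interval of integration, costing 2Bu/A.
  have key : ∀ u ∈ Set.Icc (0 : ℝ) 1,
      |(∫ x in T..T + 1, h x (x * A + u)) - ∫ x in T..T + 1, h x (x * A)| ≤ (2 * B + Λ) / A := by
    intro u hu
    have hs : 0 ≤ u / A := div_nonneg hu.1 hA.le
    have hs1 : u / A ≤ 1 / A := by gcongr; exact hu.2
    have g1 : Continuous fun x => h x (x * A) := hc2 continuous_id (by fun_prop)
    have g2 : Continuous fun x => h x (x * A + u) := hc2 continuous_id (by fun_prop)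
    have g3 : Continuous fun x => h (x + u / A) ((x + u / A) * A) :=
      hc2 (by fun_prop) (by fun_prop)
    have a1 := abs_integral_shift_sub_le g1 (fun x => hB _ _) T (u / A) hs
    have a2 := abs_intervalIntegral_unit_sub_le (C := Λ * (u / A)) T g2 g3 (by
      intro x
      have : (x + u / A) * A = x * A + u := by field_simp
      rw [this]
      refine (hL _ _ _).trans_eq ?_
      rw [sub_add_cancel_left, abs_neg, abs_of_nonneg hs])
    calc _ ≤ Λ * (u / A) + 2 * B * (u / A) := (abs_sub_le _ _ _).trans (add_le_add a2 a1)
      _ = (2 * B + Λ) * (u / A) := by ring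
      _ ≤ (2 * B + Λ) * (1 / A) := by gcongr
      _ = _ := by ring
  -- By periodicity the mean over y is the mean over phases u ∈ [0, 1], so `key` only has to be
  -- averaged over u.
  have swap : ∫ x in T..T + 1, ∫ y in (0 : ℝ)..1, h x y
      = ∫ u in (0 : ℝ)..1, ∫ x in T..T + 1, h x (x * A + u) := by
    have e : ∀ x, ∫ y in (0 : ℝ)..1, h x y = ∫ u in (0 : ℝ)..1, h x (x * A + u) := by
      intro x
      rw [intervalIntegral.integral_comp_add_left (fun y => h x y)]
      have := (show Function.Periodic (h x) 1 from hp x).intervalIntegral_add_eq 0 (x * A)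
      simpa [add_comm] using this
    simp only [e]
    exact intervalIntegral_intervalIntegral_swap (((hc2 continuous_fst (by fun_prop)).continuousOn.integrableOn_compact
      (isCompact_uIcc.prod isCompact_uIcc)).mono_set (Set.prod_mono Set.uIoc_subset_uIcc
      Set.uIoc_subset_uIcc))
  have hci : Continuous fun u => ∫ x in T..T + 1, h x (x * A + u) := by
    apply intervalIntegral.continuous_parametric_intervalIntegral_of_continuous'
    exact hc2 continuous_snd (by fun_prop)
  have e1 : (∫ x in T..T + 1, h x (x * A)) = ∫ u in (0 : ℝ)..1, ∫ x in T..T + 1, h x (x * A) := by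
    simp
  rw [swap, e1, ← intervalIntegral.integral_sub (by simp) (hci.intervalIntegrable _ _)]
  have := intervalIntegral.norm_integral_le_of_norm_le_const (a := 0) (b := 1)
    (f := fun u => (∫ x in T..T + 1, h x (x * A)) - ∫ x in T..T + 1, h x (x * A + u))
    (C := (2 * B + Λ) / A) (fun u hu => by
      rw [Real.norm_eq_abs, abs_sub_comm]
      rw [Set.uIoc_of_le zero_le_one] at hu
      exact key u ⟨hu.1.le, hu.2⟩)
  simpa using this

lemma continuous_insertNth_real {X : Type*} [TopologicalSpace X] {n : ℕ} (p : Fin (n + 1))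
    {f : X → ℝ} {g : X → Fin n → ℝ} (hf : Continuous f) (hg : Continuous g) :
    Continuous fun x => p.insertNth (α := fun _ => ℝ) (f x) (g x) :=
  hf.finInsertNth (A := fun _ : Fin (n + 1) => ℝ) p hg

namespace TorusLipschitz

/-- Averaging out one coordinate worsens neither constant, so an induction on the number of
frequencies can keep B and Λ fixed. -/
lemma insertNth {n : ℕ} {H : (Fin (n + 1) → ℝ) → ℝ} {B Λ : ℝ} (h : TorusLipschitz H B Λ)
    (p : Fin (n + 1)) (hΛ : 0 ≤ Λ) :
    TorusLipschitz (fun η => ∫ t in (0 : ℝ)..1, H (p.insertNth t η)) B Λ := by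
  have hc : ∀ η : Fin n → ℝ, Continuous fun t : ℝ => H (p.insertNth (α := fun _ => ℝ) t η) := by
    intro η
    exact h.continuous.comp (continuous_insertNth_real p continuous_id continuous_const)
  refine ⟨fun η => ?_, fun η η' => ?_, fun η m => ?_⟩
  · simpa using abs_intervalIntegral_unit_le 0 (fun t => h.bound (p.insertNth t η))
  · have := abs_intervalIntegral_unit_sub_le (C := Λ * ‖η - η'‖) 0 (hc η) (hc η') (fun t => by
      refine (h.lip _ _).trans (mul_le_mul_of_nonneg_left ?_ hΛ)
      rw [pi_norm_le_iff_of_nonneg (norm_nonneg _)]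
      intro i
      refine Fin.succAboveCases p ?_ (fun j => ?_) i
      · simp
      · simpa using norm_le_pi_norm (η - η') j)
    simpa using this
  · refine intervalIntegral.integral_congr fun t _ => ?_
    have := h.per (p.insertNth t η) (p.insertNth (α := fun _ => ℤ) 0 m)
    rw [← this]
    congr 1
    funext i
    refine Fin.succAboveCases p ?_ (fun j => ?_) i <;> simp

lemma integral_insertNth {n : ℕ} {H : (Fin (n + 1) → ℝ) → ℝ} {B Λ : ℝ}
    (h : TorusLipschitz H B Λ) (p : Fin (n + 1)) :
    ∫ η, (∫ t in (0 : ℝ)..1, H (p.insertNth t η)) ∂(cubeMeasure (Fin n))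
      = ∫ θ, H θ ∂(cubeMeasure (Fin (n + 1))) := by
  have hm := (measurePreserving_piFinSuccAbove (α := fun _ : Fin (n + 1) => ℝ)
    (fun _ => volume.restrict (Set.Ioc (0 : ℝ) 1)) p).symm
  have e := hm.integral_comp (MeasurableEquiv.measurableEmbedding _) H
  unfold cubeMeasure
  rw [← e]
  have hcont : Continuous fun z : ℝ × (Fin n → ℝ) =>
      H (p.insertNth (α := fun _ => ℝ) z.1 z.2) :=
    h.continuous.comp (continuous_insertNth_real p continuous_fst continuous_snd)
  have hint : Integrable (fun z : ℝ × (Fin n → ℝ) => H (p.insertNth (α := fun _ => ℝ) z.1 z.2))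
      ((volume.restrict (Set.Ioc (0 : ℝ) 1)).prod (cubeMeasure (Fin n))) :=
    Integrable.of_bound hcont.aestronglyMeasurable B
      (Filter.Eventually.of_forall fun z => h.bound _)
  have e2 := integral_prod_symm _ hint
  unfold cubeMeasure at e2
  simp only [intervalIntegral.integral_of_le zero_le_one]
  exact e2.symm

end TorusLipschitz

/-- Along a line with rapidly growing frequencies, a Lipschitz function on the torus has average
close to its mean. -/
theorem abs_integral_sub_cube_le_fin {n : ℕ} : ∀ {H : (Fin n → ℝ) → ℝ} {B Λ Q : ℝ},
    TorusLipschitz H B Λ → 0 ≤ Λ → 1 ≤ Q → ∀ {A : Fin n → ℝ}, (∀ i, Q ≤ A i) →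
    (∀ i j, i ≠ j → Q * A i ≤ A j ∨ Q * A j ≤ A i) → ∀ T : ℝ,
    |(∫ x in T..T + 1, H (fun i => x * A i)) - ∫ θ, H θ ∂(cubeMeasure (Fin n))|
      ≤ n * ((2 * B + Λ) / Q) := by
  induction n with
  | zero =>
    intro H B Λ Q _ _ _ A _ _ T
    have : ∀ θ : Fin 0 → ℝ, H θ = H 0 := fun θ => by rw [Subsingleton.elim θ 0]
    simp [this]
  | succ n ih =>
    intro H B Λ Q hH hΛ hQ A hA hsep T
    obtain ⟨p, -, hp⟩ := Finset.exists_max_image (Finset.univ : Finset (Fin (n + 1))) A ⟨0, by simp⟩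
    have hB := hH.bound_nonneg
    have hA0 : 0 < A p := by linarith [hA p]
    -- The frequency `A p` is maximal, so the opposite alternative of `hsep` can only hold with
    -- equality.
    have hsmall : ∀ j, Q * A (p.succAbove j) ≤ A p := by
      intro j
      rcases hsep p (p.succAbove j) (Fin.succAbove_ne p j).symm with h | h
      · have h1 := hp (p.succAbove j) (by simp)
        have : A p ≤ Q * A p := le_mul_of_one_le_left hA0.le hQ
        have e : A (p.succAbove j) = A p := by linarith
        rw [e]; rw [e] at h; exact h
      · exact h
    have hc : Continuous fun q : ℝ × ℝ =>
        H (p.insertNth (α := fun _ => ℝ) q.2 (fun j => q.1 * A (p.succAbove j))) :=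
      hH.continuous.comp (continuous_insertNth_real p continuous_snd (by fun_prop))
    -- The coordinate of largest frequency is the fast variable. The other frequencies are at most
    -- `A p / Q`, so the slow Lipschitz constant is `Λ * (A p / Q)`, and division by `A p` leaves
    -- Λ/Q.
    have step := abs_integral_sub_average_le (h := fun x t =>
        H (p.insertNth (α := fun _ => ℝ) t (fun j => x * A (p.succAbove j))))
      (B := B) (Λ := Λ * (A p / Q)) (A := A p) hc (fun _ _ => hH.bound _) (by
        intro x x' t
        refine (hH.lip _ _).trans ?_
        rw [mul_assoc]
        refine mul_le_mul_of_nonneg_left ?_ hΛ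
        rw [pi_norm_le_iff_of_nonneg (by positivity)]
        intro i
        refine Fin.succAboveCases p ?_ (fun j => ?_) i
        · simp; positivity
        · have h1 : A (p.succAbove j) ≤ A p / Q := by
            rw [le_div_iff₀ (by linarith), mul_comm]; exact hsmall j
          have h2 : 0 ≤ A (p.succAbove j) := by linarith [hA (p.succAbove j)]
          simp only [Pi.sub_apply, Fin.insertNth_apply_succAbove, ← sub_mul, Real.norm_eq_abs,
            abs_mul, abs_of_nonneg h2]
          rw [mul_comm]
          exact mul_le_mul_of_nonneg_right h1 (abs_nonneg _)) (by
        intro x t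
        have := hH.per (p.insertNth (α := fun _ => ℝ) t (fun j => x * A (p.succAbove j)))
          (p.insertNth (α := fun _ => ℤ) 1 0)
        rw [← this]
        congr 1
        funext i
        refine Fin.succAboveCases p ?_ (fun j => ?_) i <;> simp) hA0 T
    have ih' := ih (hH.insertNth p hΛ) hΛ hQ (A := fun j => A (p.succAbove j))
      (fun j => hA _) (fun i j hij => hsep _ _ (fun h => hij (Fin.succAbove_right_injective h))) T
    rw [hH.integral_insertNth p] at ih'
    have e : ∀ x, (p.insertNth (α := fun _ => ℝ) (x * A p) (fun j => x * A (p.succAbove j)))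
        = fun i => x * A i := by
      intro x; funext i
      refine Fin.succAboveCases p ?_ (fun j => ?_) i <;> simp
    simp only [e] at step
    have hle : (2 * B + Λ * (A p / Q)) / A p ≤ (2 * B + Λ) / Q := by
      rw [add_div, add_div]
      have h1 : 2 * B / A p ≤ 2 * B / Q := by gcongr; exact hA p
      have h2 : Λ * (A p / Q) / A p = Λ / Q := by field_simp
      linarith
    calc _ ≤ _ := abs_sub_le _ _ _
      _ ≤ (2 * B + Λ) / Q + n * ((2 * B + Λ) / Q) := add_le_add (step.trans hle) ih'
      _ = _ := by push_cast; ring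

theorem abs_integral_sub_cube_le {ι : Type*} [Fintype ι] {H : (ι → ℝ) → ℝ} {B Λ Q : ℝ}
    (hH : TorusLipschitz H B Λ) (hΛ : 0 ≤ Λ) (hQ : 1 ≤ Q) {A : ι → ℝ} (hA : ∀ i, Q ≤ A i)
    (hsep : ∀ i j, i ≠ j → Q * A i ≤ A j ∨ Q * A j ≤ A i) (T : ℝ) :
    |(∫ x in T..T + 1, H (fun i => x * A i)) - ∫ θ, H θ ∂(cubeMeasure ι)|
      ≤ Fintype.card ι * ((2 * B + Λ) / Q) := by
  let e := (Fintype.equivFin ι).symm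
  have hH' : TorusLipschitz (fun θ : Fin (Fintype.card ι) → ℝ => H (fun i => θ (e.symm i))) B Λ := by
    refine ⟨fun θ => hH.bound _, fun θ θ' => (hH.lip _ _).trans ?_, fun θ m => ?_⟩
    · refine mul_le_mul_of_nonneg_left ?_ hΛ
      rw [pi_norm_le_iff_of_nonneg (norm_nonneg _)]
      exact fun i => norm_le_pi_norm (θ - θ') (e.symm i)
    · exact hH.per (fun i => θ (e.symm i)) (fun i => m (e.symm i))
  have := abs_integral_sub_cube_le_fin hH' hΛ hQ (A := fun i => A (e i)) (fun i => hA _)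
    (fun i j hij => hsep _ _ (fun h => hij (e.injective h))) T
  simp only [Equiv.apply_symm_apply] at this
  convert this using 3
  have hm := measurePreserving_piCongrLeft (α := fun _ : ι => ℝ)
    (fun _ => volume.restrict (Set.Ioc (0 : ℝ) 1)) e
  have e3 := hm.integral_comp (MeasurableEquiv.measurableEmbedding _) H
  unfold cubeMeasure
  rw [← e3]
  refine integral_congr_ae (Filter.Eventually.of_forall fun θ => ?_)
  show H _ = H _
  congr 1
  funext i
  obtain ⟨j, rfl⟩ := e.surjective i
  rw [MeasurableEquiv.coe_piCongrLeft, Equiv.piCongrLeft_apply_apply, Equiv.symm_apply_apply]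

/-! ### Distance to the nearest integer and hat functions -/

/-- The distance of a real number to the nearest integer. -/
noncomputable def dInt (t : ℝ) : ℝ := ‖(t : UnitAddCircle)‖

lemma dInt_nonneg (t : ℝ) : 0 ≤ dInt t := norm_nonneg _

lemma dInt_add_le (s t : ℝ) : dInt (s + t) ≤ dInt s + dInt t := by
  unfold dInt; rw [AddCircle.coe_add]; exact norm_add_le _ _

lemma dInt_neg (t : ℝ) : dInt (-t) = dInt t := by
  unfold dInt; rw [AddCircle.coe_neg, norm_neg]

lemma dInt_sub_comm (s t : ℝ) : dInt (s - t) = dInt (t - s) := by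
  rw [← dInt_neg, neg_sub]

lemma dInt_sub_le (s t u : ℝ) : dInt (s - u) ≤ dInt (s - t) + dInt (t - u) := by
  have := dInt_add_le (s - t) (t - u); rwa [sub_add_sub_cancel] at this

lemma dInt_eq (t : ℝ) : dInt t = |t - round t| := UnitAddCircle.norm_eq

lemma dInt_le_abs (t : ℝ) : dInt t ≤ |t| := by
  rw [dInt_eq]; simpa using round_le t 0

lemma dInt_add_int (t : ℝ) (m : ℤ) : dInt (t + m) = dInt t := by
  rw [dInt_eq, dInt_eq, round_add_intCast]; push_cast; congr 1; ring

lemma abs_dInt_sub_le (s t : ℝ) : |dInt s - dInt t| ≤ |s - t| := by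
  rw [abs_sub_le_iff]
  constructor
  · have := dInt_add_le (s - t) t
    have h2 := dInt_le_abs (s - t)
    rw [sub_add_cancel] at this; linarith
  · have := dInt_add_le (t - s) s
    have h2 := dInt_le_abs (t - s)
    rw [sub_add_cancel] at this; rw [abs_sub_comm] at h2; linarith

lemma dInt_eq_abs {t : ℝ} (h : |t| ≤ 1 / 2) : dInt t = |t| :=
  (AddCircle.norm_coe_eq_abs_iff (p := 1) (x := t) one_ne_zero).2 (by simpa using h)

lemma continuous_dInt : Continuous dInt :=
  continuous_norm.comp (AddCircle.continuous_mk' 1)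

/-- The hat function on `ℝ` supported on `[-1, 1]`. -/
noncomputable def tent (t : ℝ) : ℝ := max 0 (1 - |t|)

lemma tent_nonneg (t : ℝ) : 0 ≤ tent t := le_max_left _ _

lemma tent_eq_zero {t : ℝ} (h : 1 ≤ |t|) : tent t = 0 := max_eq_left (by linarith)

lemma continuous_tent : Continuous tent := by unfold tent; fun_prop

/-- The hat function of height `1` and width `2 / A` around `w + ℤ`. -/
noncomputable def pTent (A w t : ℝ) : ℝ := max 0 (1 - A * dInt (t - w))

lemma pTent_nonneg (A w t : ℝ) : 0 ≤ pTent A w t := le_max_left _ _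

lemma pTent_le_one {A : ℝ} (hA : 0 ≤ A) (w t : ℝ) : pTent A w t ≤ 1 :=
  max_le zero_le_one (by have := mul_nonneg hA (dInt_nonneg (t - w)); linarith)

lemma pTent_eq_tent (A w t : ℝ) (hA : 0 ≤ A) :
    pTent A w t = tent (A * (t - w - round (t - w))) := by
  unfold pTent tent; rw [dInt_eq, abs_mul, abs_of_nonneg hA]

lemma continuous_pTent (A w : ℝ) : Continuous (pTent A w) :=
  continuous_const.max (continuous_const.sub
    (continuous_const.mul (continuous_dInt.comp (continuous_id.sub continuous_const))))

lemma pTent_add_int (A w t : ℝ) (m : ℤ) : pTent A w (t + m) = pTent A w t := by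
  unfold pTent; rw [show t + (m : ℝ) - w = t - w + m by ring, dInt_add_int]

lemma abs_pTent_sub_le {A : ℝ} (hA : 0 ≤ A) (w s t : ℝ) :
    |pTent A w s - pTent A w t| ≤ A * |s - t| := by
  unfold pTent
  refine (abs_max_sub_max_le_max _ _ _ _).trans (max_le (by simp; positivity) ?_)
  rw [show 1 - A * dInt (s - w) - (1 - A * dInt (t - w)) = A * (dInt (t - w) - dInt (s - w)) by ring,
    abs_mul, abs_of_nonneg hA]
  refine mul_le_mul_of_nonneg_left ((abs_dInt_sub_le _ _).trans_eq ?_) hA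
  rw [abs_sub_comm]; congr 1; ring

lemma dInt_lt_of_pTent_ne_zero {A w t : ℝ} (hA : 0 < A) (h : pTent A w t ≠ 0) :
    dInt (t - w) < 1 / A := by
  by_contra hc
  push Not at hc
  apply h
  refine max_eq_left ?_
  rw [div_le_iff₀' hA] at hc
  linarith

/-- The integral of the hat function. -/
noncomputable def tentMass : ℝ := ∫ t, tent t

lemma integral_pTent {A : ℝ} (hA : 2 ≤ A) (w : ℝ) :
    ∫ t in (0 : ℝ)..1, pTent A w t = tentMass / A := by
  have hA0 : 0 < A := by linarith
  have e1 : ∫ t in (0 : ℝ)..1, pTent A w t = ∫ t in (w - 1 / 2)..(w - 1 / 2) + 1, pTent A w t := by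
    have hp : Function.Periodic (pTent A w) 1 := fun t => by simpa using pTent_add_int A w t 1
    simpa using hp.intervalIntegral_add_eq 0 (w - 1 / 2)
  have e2 : ∫ t in (w - 1 / 2)..(w - 1 / 2) + 1, pTent A w t
      = ∫ t in (-(1 / 2) : ℝ)..1 / 2, tent (A * t) := by
    have := intervalIntegral.integral_comp_add_right (a := -(1 / 2)) (b := 1 / 2)
      (fun t => pTent A w t) w
    rw [show (w - 1 / 2) + 1 = 1 / 2 + w by ring, show w - 1 / 2 = -(1 / 2) + w by ring, ← this]
    refine intervalIntegral.integral_congr fun t ht => ?_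
    rw [Set.uIcc_of_le (by norm_num)] at ht
    simp only [pTent, tent]
    rw [add_sub_cancel_right, dInt_eq_abs (abs_le.2 ht), abs_mul, abs_of_pos hA0]
  rw [e1, e2, intervalIntegral.integral_comp_mul_left _ hA0.ne',
    intervalIntegral.integral_eq_integral_of_support_subset]
  · rw [smul_eq_mul, tentMass]; field_simp
  · intro t ht
    have : |t| < 1 := by
      by_contra hc
      exact ht (tent_eq_zero (not_lt.1 hc))
    rw [abs_lt] at this
    constructor <;> nlinarith

lemma integral_tent_affine {M : ℝ} (hM : 0 < M) (v : ℝ) :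
    ∫ t, tent (M * t - v) = tentMass / M := by
  have := Measure.integral_comp_mul_left (fun t => tent (t - v)) M
  rw [this, integral_sub_right_eq_self, smul_eq_mul, tentMass, abs_of_pos (inv_pos.2 hM)]
  field_simp

/-! ### Periodic Lipschitz test functions and their means -/

namespace TorusLipschitz

variable {ι κ : Type*} [Fintype ι] [Fintype κ]

lemma mul {H H' : (ι → ℝ) → ℝ} {Λ Λ' : ℝ} (h : TorusLipschitz H 1 Λ) (h' : TorusLipschitz H' 1 Λ') :
    TorusLipschitz (fun θ => H θ * H' θ) 1 (Λ + Λ') := by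
  refine ⟨fun θ => ?_, fun θ θ' => ?_, fun θ m => ?_⟩
  · rw [abs_mul]; exact mul_le_one₀ (h.bound θ) (abs_nonneg _) (h'.bound θ)
  · have e : H θ * H' θ - H θ' * H' θ' = (H θ - H θ') * H' θ + H θ' * (H' θ - H' θ') := by ring
    rw [e, add_mul]
    refine (abs_add_le _ _).trans (add_le_add ?_ ?_)
    · rw [abs_mul]
      exact (mul_le_of_le_one_right (abs_nonneg _) (h'.bound θ)).trans (h.lip θ θ')
    · rw [abs_mul]
      exact (mul_le_of_le_one_left (abs_nonneg _) (h.bound θ')).trans (h'.lip θ θ')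
  · rw [h.per, h'.per]

lemma one : TorusLipschitz (fun _ : ι → ℝ => (1 : ℝ)) 1 0 :=
  ⟨fun _ => by simp, fun _ _ => by simp, fun _ _ => rfl⟩

lemma prod {σ : Type*} (s : Finset σ) {H : σ → (ι → ℝ) → ℝ} {Λ : ℝ}
    (h : ∀ i ∈ s, TorusLipschitz (H i) 1 Λ) :
    TorusLipschitz (fun θ => ∏ i ∈ s, H i θ) 1 (s.card * Λ) := by
  classical
  induction s using Finset.induction_on with
  | empty => simpa using one
  | insert a s ha ih =>
    have h1 := (h a (by simp)).mul (ih fun i hi => h i (by simp [hi]))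
    rw [Finset.card_insert_of_notMem ha]
    simp only [Finset.prod_insert ha]
    convert h1 using 1
    push_cast; ring

lemma comp {H : (ι → ℝ) → ℝ} {B Λ : ℝ} (h : TorusLipschitz H B Λ) (hΛ : 0 ≤ Λ) (σ : ι → κ) :
    TorusLipschitz (fun θ : κ → ℝ => H (fun i => θ (σ i))) B Λ := by
  refine ⟨fun θ => h.bound _, fun θ θ' => (h.lip _ _).trans ?_, fun θ m => ?_⟩
  · refine mul_le_mul_of_nonneg_left ?_ hΛ
    rw [pi_norm_le_iff_of_nonneg (norm_nonneg _)]
    exact fun i => norm_le_pi_norm (θ - θ') (σ i)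
  · exact h.per (fun i => θ (σ i)) (fun i => m (σ i))

lemma coord {A : ℝ} (hA : 0 ≤ A) (w : ℝ) (i : ι) :
    TorusLipschitz (fun θ => pTent A w (θ i)) 1 A := by
  refine ⟨fun θ => ?_, fun θ θ' => ?_, fun θ m => pTent_add_int _ _ _ _⟩
  · rw [abs_of_nonneg (pTent_nonneg _ _ _)]; exact pTent_le_one hA _ _
  · exact (abs_pTent_sub_le hA _ _ _).trans
      (mul_le_mul_of_nonneg_left (norm_le_pi_norm (θ - θ') i) hA)

lemma coord_sub {A : ℝ} (hA : 0 ≤ A) (w : ℝ) (i j : ι) :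
    TorusLipschitz (fun θ => pTent A w (θ i - θ j)) 1 (2 * A) := by
  refine ⟨fun θ => ?_, fun θ θ' => ?_, fun θ m => ?_⟩
  · rw [abs_of_nonneg (pTent_nonneg _ _ _)]; exact pTent_le_one hA _ _
  · refine (abs_pTent_sub_le hA _ _ _).trans ?_
    rw [mul_comm 2, mul_assoc]
    refine mul_le_mul_of_nonneg_left ?_ hA
    have h1 := norm_le_pi_norm (θ - θ') i
    have h2 := norm_le_pi_norm (θ - θ') j
    rw [show θ i - θ j - (θ' i - θ' j) = (θ - θ') i - (θ - θ') j by simp; ring]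
    refine (abs_sub _ _).trans ?_
    simp only [Real.norm_eq_abs] at h1 h2 ⊢
    linarith
  · have := pTent_add_int A w (θ i - θ j) (m i - m j)
    rw [← this]; congr 1; push_cast; ring

lemma sub_const {H : (ι → ℝ) → ℝ} {Λ μ : ℝ} (h : TorusLipschitz H 1 Λ) (h0 : ∀ θ, 0 ≤ H θ)
    (hμ : 0 ≤ μ) (hμ1 : μ ≤ 1) : TorusLipschitz (fun θ => H θ - μ) 1 Λ := by
  refine ⟨fun θ => ?_, fun θ θ' => ?_, fun θ m => ?_⟩
  · have := h.bound θ
    have := h0 θ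
    rw [abs_le] at *; constructor <;> linarith
  · rw [sub_sub_sub_cancel_right]; exact h.lip θ θ'
  · rw [h.per]

end TorusLipschitz

/-- The `N`-scaled, periodized test function evaluated at consecutive differences. -/
noncomputable def diffTent {n : ℕ} (A : ℝ) (w : Fin n → ℝ) (θ : Fin (n + 1) → ℝ) : ℝ :=
  ∏ i : Fin n, pTent A (w i) (θ i.castSucc - θ i.succ)

lemma diffTent_nonneg {n : ℕ} (A : ℝ) (w : Fin n → ℝ) (θ : Fin (n + 1) → ℝ) :
    0 ≤ diffTent A w θ := Finset.prod_nonneg fun _ _ => pTent_nonneg _ _ _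

lemma diffTent_le_one {n : ℕ} {A : ℝ} (hA : 0 ≤ A) (w : Fin n → ℝ) (θ : Fin (n + 1) → ℝ) :
    diffTent A w θ ≤ 1 :=
  Finset.prod_le_one (fun _ _ => pTent_nonneg _ _ _) fun _ _ => pTent_le_one hA _ _

lemma torusLipschitz_diffTent {n : ℕ} {A : ℝ} (hA : 0 ≤ A) (w : Fin n → ℝ) :
    TorusLipschitz (diffTent A w) 1 (n * (2 * A)) := by
  have := TorusLipschitz.prod (Finset.univ : Finset (Fin n))
    (H := fun i (θ : Fin (n + 1) → ℝ) => pTent A (w i) (θ i.castSucc - θ i.succ))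
    (fun i _ => TorusLipschitz.coord_sub hA (w i) i.castSucc i.succ)
  rw [Finset.card_univ, Fintype.card_fin] at this
  exact this

/-- The coordinate θ₀ occurs only in the first factor, and integrating it out gives `tentMass / A`
whatever θ₁ is. Iterating peels off all n factors; the last coordinate contributes 1. -/
lemma integral_diffTent {n : ℕ} {A : ℝ} (hA : 2 ≤ A) : ∀ w : Fin n → ℝ,
    ∫ θ, diffTent A w θ ∂(cubeMeasure (Fin (n + 1))) = (tentMass / A) ^ n := by
  have hA0 : 0 ≤ A := by linarith
  induction n with
  | zero => intro w; simp [diffTent]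
  | succ n ih =>
    intro w
    rw [← (torusLipschitz_diffTent hA0 w).integral_insertNth 0]
    have e : ∀ η : Fin (n + 1) → ℝ,
        ∫ t in (0 : ℝ)..1, diffTent A w ((0 : Fin (n + 2)).insertNth t η)
        = tentMass / A * diffTent A (fun i => w i.succ) η := by
      intro η
      have e1 : ∀ t : ℝ, diffTent A w ((0 : Fin (n + 2)).insertNth t η)
          = pTent A (w 0) (t - η 0) * diffTent A (fun i => w i.succ) η := by
        intro t
        simp only [diffTent, Fin.insertNth_zero']
        rw [Fin.prod_univ_succ]
        congr 1
      simp only [e1]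
      rw [intervalIntegral.integral_mul_const]
      congr 1
      have : ∀ t, pTent A (w 0) (t - η 0) = pTent A (w 0 + η 0) t := by
        intro t; unfold pTent; congr 3; ring_nf
      simp only [this]
      exact integral_pTent hA _
    simp only [e]
    rw [integral_const_mul, ih, pow_succ]
    ring

/-- Independence of two blocks of coordinates; this is why jointly separated tuples are uncorrelated
in the second moment. -/
lemma integral_cube_sum_mul {ι κ : Type*} [Fintype ι] [Fintype κ] (f : (ι → ℝ) → ℝ)
    (g : (κ → ℝ) → ℝ) :
    ∫ θ : ι ⊕ κ → ℝ, f (fun i => θ (Sum.inl i)) * g (fun i => θ (Sum.inr i)) ∂(cubeMeasure (ι ⊕ κ))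
      = (∫ θ, f θ ∂(cubeMeasure ι)) * ∫ θ, g θ ∂(cubeMeasure κ) := by
  have hm := measurePreserving_sumPiEquivProdPi (X := fun _ : ι ⊕ κ => ℝ)
    (fun _ => volume.restrict (Set.Ioc (0 : ℝ) 1))
  have := hm.integral_comp (MeasurableEquiv.measurableEmbedding _) (fun z => f z.1 * g z.2)
  unfold cubeMeasure
  rw [← integral_prod_mul]
  exact this

lemma integral_cube_prod_pTent {ι : Type*} [Fintype ι] {A : ℝ} (hA : 2 ≤ A) (w : ℝ) :
    ∫ θ : ι → ℝ, ∏ i, pTent A w (θ i) ∂(cubeMeasure ι) = (tentMass / A) ^ Fintype.card ι := by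
  unfold cubeMeasure
  rw [integral_fintype_prod_eq_prod (fun _ : ι => pTent A w)]
  simp_rw [← intervalIntegral.integral_of_le zero_le_one, integral_pTent hA]
  simp [div_pow]

/-- The test functions `y ↦ ∏ tent (M yᵢ - vᵢ)`. -/
noncomputable def tentProd {n : ℕ} (M : ℝ) (v : Fin n → ℤ) (y : Fin n → ℝ) : ℝ :=
  ∏ i, tent (M * y i - v i)

/-- This matches `integral_diffTent`: N^(n+1) tuples of mean `(tentMass / (N * M)) ^ n`, divided by
N, give the same value. Hence `tentMass` itself never has to be evaluated. -/
lemma integral_tentProd {n : ℕ} {M : ℝ} (hM : 0 < M) (v : Fin n → ℤ) :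
    ∫ y, tentProd M v y = (tentMass / M) ^ n := by
  unfold tentProd
  rw [volume_pi, integral_fintype_prod_eq_prod (fun (i : Fin n) t => tent (M * t - v i))]
  simp_rw [integral_tent_affine hM]
  simp [div_pow]

/-- Each scaled hat has width 2/(NM) ≤ 1, so in every coordinate only the nearest integer can
contribute. -/
lemma tsum_tentProd {n : ℕ} {N M : ℝ} (hN : 0 < N) (hM : 0 < M) (h : 2 ≤ N * M) (v : Fin n → ℤ)
    (s : Fin n → ℝ) :
    ∑' m : Fin n → ℤ, tentProd M v (fun i => N * (s i - m i))
      = ∏ i, pTent (N * M) (v i / (N * M)) (s i) := by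
  have hA : 0 < N * M := by positivity
  have e : ∀ (m : ℤ) i, M * (N * (s i - m)) - v i = N * M * (s i - v i / (N * M) - m) := by
    intro m i; field_simp; ring
  rw [tsum_eq_single (fun i => round (s i - v i / (N * M)))]
  · refine Finset.prod_congr rfl fun i _ => ?_
    rw [pTent_eq_tent _ _ _ hA.le, e]
  · intro m hm
    obtain ⟨i, hi⟩ := Function.ne_iff.1 hm
    refine Finset.prod_eq_zero (Finset.mem_univ i) ?_
    rw [e]
    refine tent_eq_zero ?_
    rw [abs_mul, abs_of_pos hA]
    set t := s i - v i / (N * M)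
    have h1 : (1 : ℝ) ≤ |(m i : ℝ) - round t| := by
      have : (1 : ℤ) ≤ |m i - round t| := Int.one_le_abs (sub_ne_zero.2 hi)
      exact_mod_cast this
    have h2 := abs_sub_round t
    have h3 : |(m i : ℝ) - round t| ≤ |t - m i| + |t - round t| := by
      rw [abs_sub_comm t]; exact abs_sub_le _ _ _
    nlinarith

/-! ### Growth of the sequence and separated indices -/

/-- Quantitative growth of a sequence beyond the index `L`, with steps of length `L`. -/
structure Growth (a : ℕ → ℝ) (L : ℕ) (Q : ℝ) : Prop where
  large : ∀ z, L < z → Q ≤ a z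
  ratio : ∀ z z', L < z → z + L ≤ z' → Q * a z ≤ a z'
  diff : ∀ z z', L < z → z < z' → Q ≤ a z' - a z

/-- All indices exceed `L`, and any two of them differ by at least `L`. -/
def Separated {ι : Type*} (L : ℕ) (z : ι → ℕ) : Prop :=
  (∀ i, L < z i) ∧ ∀ i j, i ≠ j → z i + L ≤ z j ∨ z j + L ≤ z i

/-- Separated indices turn `large` and `ratio` into the frequency hypotheses of the torus average.
-/
lemma Growth.abs_integral_sub_cube_le {a : ℕ → ℝ} {L : ℕ} {Q : ℝ} (ha : Growth a L Q)
    {ι : Type*} [Fintype ι] {H : (ι → ℝ) → ℝ} {B Λ : ℝ}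
    (hH : TorusLipschitz H B Λ) (hΛ : 0 ≤ Λ) (hQ : 1 ≤ Q) {z : ι → ℕ} (hz : Separated L z) (T : ℝ) :
    |(∫ x in T..T + 1, H (fun i => x * a (z i))) - ∫ θ, H θ ∂(cubeMeasure ι)|
      ≤ Fintype.card ι * ((2 * B + Λ) / Q) :=
  _root_.abs_integral_sub_cube_le hH hΛ hQ (A := fun i => a (z i)) (fun i => ha.large _ (hz.1 i))
    (fun i j hij => (hz.2 i j hij).imp (fun h => ha.ratio _ _ (hz.1 i) h)
      (fun h => ha.ratio _ _ (hz.1 j) h)) T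

/-! ### Moments of the number of points in short arcs -/

/-- For m ≥ 2q one has m ≤ 2(m + 1 - q), and (m + 1 - q)^q is at most the falling factorial. Powers
are thus traded for binomial coefficients, which count sets of distinct indices. -/
lemma pow_le_add_choose (m q : ℕ) :
    m ^ q ≤ (2 * q) ^ q + 2 ^ q * q.factorial * m.choose q := by
  rcases lt_or_ge m (2 * q) with h | h
  · exact (Nat.pow_le_pow_left h.le q).trans (Nat.le_add_right _ _)
  · calc m ^ q ≤ (2 * (m + 1 - q)) ^ q := Nat.pow_le_pow_left (by omega) q
      _ = 2 ^ q * (m + 1 - q) ^ q := by rw [mul_pow]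
      _ ≤ 2 ^ q * m.descFactorial q := Nat.mul_le_mul_left _ (Nat.pow_sub_le_descFactorial m q)
      _ = 2 ^ q * q.factorial * m.choose q := by
        rw [Nat.descFactorial_eq_factorial_mul_choose, mul_assoc]
      _ ≤ _ := Nat.le_add_left _ _

/-- The q-subsets of the filtered set each contribute at least 1 to the elementary symmetric sum of
u, whose products can be integrated one by one. -/
lemma choose_card_filter_le {s : Finset ℕ} {p : ℕ → Prop} [DecidablePred p] {u : ℕ → ℝ}
    (hu : ∀ y, 0 ≤ u y) (hp : ∀ y, p y → 1 ≤ u y) (q : ℕ) :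
    (((s.filter p).card.choose q : ℕ) : ℝ) ≤ ∑ S ∈ s.powersetCard q, ∏ y ∈ S, u y := by
  rw [← Finset.card_powersetCard, Finset.card_eq_sum_ones, Nat.cast_sum]
  calc _ ≤ ∑ S ∈ (s.filter p).powersetCard q, ∏ y ∈ S, u y := by
        refine Finset.sum_le_sum fun S hS => ?_
        rw [Finset.mem_powersetCard] at hS
        simp only [Nat.cast_one]
        calc (1 : ℝ) = ∏ y ∈ S, (1 : ℝ) := by simp
          _ ≤ ∏ y ∈ S, u y := Finset.prod_le_prod (fun _ _ => zero_le_one)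
            (fun y hy => hp y (Finset.mem_filter.1 (hS.1 hy)).2)
    _ ≤ _ := Finset.sum_le_sum_of_subset_of_nonneg
        (Finset.powersetCard_mono (Finset.filter_subset _ _))
        fun S _ _ => Finset.prod_nonneg fun y _ => hu y

/-- A continuous periodic majorant of the indicator function of `dInt (t - h / N) ≤ (K + 1) / N`. -/
noncomputable def gridTent (N K h t : ℝ) : ℝ := 2 * pTent (N / (2 * (K + 1))) (h / N) t

lemma gridTent_nonneg (N K h t : ℝ) : 0 ≤ gridTent N K h t :=
  mul_nonneg zero_le_two (pTent_nonneg _ _ _)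

lemma one_le_gridTent {N K h t : ℝ} (hN : 0 < N) (hK : 0 ≤ K)
    (ht : dInt (t - h / N) ≤ (K + 1) / N) : 1 ≤ gridTent N K h t := by
  have : N / (2 * (K + 1)) * dInt (t - h / N) ≤ 1 / 2 := by
    calc _ ≤ N / (2 * (K + 1)) * ((K + 1) / N) := by gcongr
      _ = 1 / 2 := by field_simp
  have := le_max_right 0 (1 - N / (2 * (K + 1)) * dInt (t - h / N))
  unfold gridTent pTent
  linarith

lemma continuous_gridTent (N K h : ℝ) : Continuous (gridTent N K h) :=
  continuous_const.mul (continuous_pTent _ _)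

/-- The indices `y ≤ N` with `α a_y` within `K / N` of `α a_p` modulo `1`. -/
noncomputable def ball (a : ℕ → ℝ) (N K : ℕ) (α : ℝ) (p : ℕ) : Finset ℕ :=
  (Finset.Icc 1 N).filter fun y => dInt (α * a y - α * a p) ≤ (K : ℝ) / N

/-- The indices `y ≤ N` with `α a_y` within `(K + 1) / N` of `h / N` modulo `1`. -/
noncomputable def cell (a : ℕ → ℝ) (N K : ℕ) (α : ℝ) (h : ℕ) : Finset ℕ :=
  (Finset.Icc 1 N).filter fun y => dInt (α * a y - h / N) ≤ ((K : ℝ) + 1) / N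

lemma exists_dInt_sub_le {N : ℕ} (hN : 1 ≤ N) (t : ℝ) :
    ∃ h ∈ Finset.range N, dInt (t - h / N) ≤ 1 / N := by
  have hN0 : (0 : ℝ) < N := by exact_mod_cast hN
  have h0 : 0 ≤ N * Int.fract t := mul_nonneg hN0.le (Int.fract_nonneg t)
  refine ⟨⌊N * Int.fract t⌋₊, ?_, ?_⟩
  · rw [Finset.mem_range, Nat.floor_lt h0]
    have := Int.fract_lt_one t
    nlinarith
  · have e : t - (⌊N * Int.fract t⌋₊ : ℝ) / N
        = (Int.fract t - (⌊N * Int.fract t⌋₊ : ℝ) / N) + (⌊t⌋ : ℤ) := by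
      rw [Int.fract]; ring
    rw [e, dInt_add_int]
    refine (dInt_le_abs _).trans ?_
    have h1 := Nat.floor_le h0
    have h2 := Nat.lt_floor_add_one (N * Int.fract t)
    rw [abs_le]
    have e2 : Int.fract t = (N * Int.fract t) / N := by field_simp
    rw [e2, ← sub_div]
    constructor
    · have : 0 ≤ (N * Int.fract t - ⌊N * Int.fract t⌋₊) / N := div_nonneg (by linarith) hN0.le
      have : 0 ≤ 1 / (N : ℝ) := by positivity
      rw [← e2]; rw [← e2] at *; linarith
    · rw [← e2]; gcongr; linarith

/-- This replaces the moving centres α·a_p by N fixed ones. Rounding α·a_p to the grid h/N puts its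
ball inside a cell, and the p rounded to a given h lie in that cell too, whence the extra factor and
the exponent q + 1. -/
lemma sum_card_ball_pow_le (a : ℕ → ℝ) {N : ℕ} (hN : 1 ≤ N) (K : ℕ) (α : ℝ) (q : ℕ) :
    ∑ p ∈ Finset.Icc 1 N, (ball a N K α p).card ^ q
      ≤ ∑ h ∈ Finset.range N, (cell a N K α h).card ^ (q + 1) := by
  choose g hg hg' using fun t => exists_dInt_sub_le hN t
  have hsub : ∀ p, ball a N K α p ⊆ cell a N K α (g (α * a p)) := by
    intro p y hy
    rw [ball, Finset.mem_filter] at hy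
    rw [cell, Finset.mem_filter]
    refine ⟨hy.1, (dInt_sub_le _ (α * a p) _).trans ?_⟩
    rw [add_div]
    exact add_le_add hy.2 (hg' _)
  calc _ ≤ ∑ p ∈ Finset.Icc 1 N, (cell a N K α (g (α * a p))).card ^ q :=
        Finset.sum_le_sum fun p _ => Nat.pow_le_pow_left (Finset.card_le_card (hsub p)) q
    _ = ∑ h ∈ Finset.range N, ∑ p ∈ (Finset.Icc 1 N).filter (fun p => g (α * a p) = h),
          (cell a N K α (g (α * a p))).card ^ q :=
        (Finset.sum_fiberwise_of_maps_to (fun p _ => hg _) _).symm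
    _ ≤ _ := by
      refine Finset.sum_le_sum fun h _ => ?_
      calc _ = ∑ p ∈ (Finset.Icc 1 N).filter (fun p => g (α * a p) = h),
            (cell a N K α h).card ^ q :=
            Finset.sum_congr rfl fun p hp => by rw [(Finset.mem_filter.1 hp).2]
        _ = ((Finset.Icc 1 N).filter (fun p => g (α * a p) = h)).card *
            (cell a N K α h).card ^ q := by rw [Finset.sum_const, smul_eq_mul]
        _ ≤ (cell a N K α h).card * (cell a N K α h).card ^ q := by
          refine Nat.mul_le_mul_right _ (Finset.card_le_card fun p hp => ?_)
          rw [Finset.mem_filter] at hp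
          rw [cell, Finset.mem_filter]
          refine ⟨hp.1, ?_⟩
          have := hg' (α * a p)
          rw [hp.2] at this
          refine this.trans ?_
          gcongr
          have : (0 : ℝ) ≤ K := Nat.cast_nonneg K
          linarith
        _ = _ := by rw [pow_succ, mul_comm]

/-- The indices in `(L, N]` congruent to `r` modulo `L`. -/
def residueIndices (L N r : ℕ) : Finset ℕ := (Finset.Ioc L N).filter fun y => y % L = r

/-- Distinct members of one residue class modulo L differ by a nonzero multiple of L. -/
lemma separated_of_subset_residueIndices {L N r : ℕ} {S : Finset ℕ}
    (hS : S ⊆ residueIndices L N r) : Separated L (fun y : S => (y : ℕ)) := by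
  have hmem : ∀ y : S, L < (y : ℕ) ∧ (y : ℕ) % L = r := fun y => by
    have := hS y.2
    rw [residueIndices, Finset.mem_filter, Finset.mem_Ioc] at this
    exact ⟨this.1.1, this.2⟩
  refine ⟨fun y => (hmem y).1, fun y y' hne => ?_⟩
  have key : ∀ u w : ℕ, u % L = r → w % L = r → u < w → u + L ≤ w := by
    intro u w hu hw huw
    have h1 : L ∣ w - u := (Nat.modEq_iff_dvd' huw.le).1 (show u % L = w % L by rw [hu, hw])
    have := Nat.le_of_dvd (by omega) h1
    omega
  rcases lt_or_gt_of_ne (fun h => hne (Subtype.ext h) : (y : ℕ) ≠ y') with h | h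
  · exact Or.inl (key _ _ (hmem y).2 (hmem y').2 h)
  · exact Or.inr (key _ _ (hmem y').2 (hmem y).2 h)

lemma card_filter_le_add_residue {L N : ℕ} (hL : 1 ≤ L) (p : ℕ → Prop) [DecidablePred p] :
    ((Finset.Icc 1 N).filter p).card
      ≤ L + ∑ r ∈ Finset.range L, ((residueIndices L N r).filter p).card := by
  have : (Finset.Icc 1 N).filter p ⊆
      Finset.Icc 1 L ∪ (Finset.range L).biUnion fun r => (residueIndices L N r).filter p := by
    intro y hy
    rw [Finset.mem_filter, Finset.mem_Icc] at hy
    rw [Finset.mem_union, Finset.mem_biUnion, Finset.mem_Icc]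
    rcases le_or_gt y L with h | h
    · exact Or.inl ⟨hy.1.1, h⟩
    · refine Or.inr ⟨y % L, Finset.mem_range.2 (Nat.mod_lt _ hL), ?_⟩
      simp only [residueIndices, Finset.mem_filter, Finset.mem_Ioc]
      exact ⟨⟨⟨h, hy.1.2⟩, trivial⟩, hy.2⟩
  calc _ ≤ _ := Finset.card_le_card this
    _ ≤ _ := Finset.card_union_le _ _
    _ ≤ _ := by
      refine add_le_add (by simp) Finset.card_biUnion_le

lemma add_sum_pow_le {L : ℕ} (x : ℝ) (hx : 0 ≤ x) (f : ℕ → ℝ) (hf : ∀ r, 0 ≤ f r) (q : ℕ) :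
    (x + ∑ r ∈ Finset.range L, f r) ^ (q + 1)
      ≤ 2 ^ q * (x ^ (q + 1) + L ^ q * ∑ r ∈ Finset.range L, f r ^ (q + 1)) := by
  have h1 := add_pow_le hx (Finset.sum_nonneg fun r (_ : r ∈ Finset.range L) => hf r) (q + 1)
  rw [Nat.add_sub_cancel] at h1
  refine h1.trans ?_
  gcongr
  rcases Nat.eq_zero_or_pos L with rfl | hL
  · simp
  · have h2 := pow_sum_div_card_le_sum_pow (s := Finset.range L) (fun r _ => hf r) q
    rw [Finset.card_range, div_le_iff₀ (by positivity)] at h2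
    linarith

lemma continuous_prod_gridTent (a : ℕ → ℝ) (N K h : ℝ) (S : Finset ℕ) :
    Continuous fun α : ℝ => ∏ y ∈ S, gridTent N K h (α * a y) :=
  continuous_finsetProd _ fun y _ => (continuous_gridTent N K h).comp (by fun_prop)

lemma tentMass_nonneg : 0 ≤ tentMass := integral_nonneg tent_nonneg

/-- For separated indices the factors are nearly independent: the first term is the product of their
means, the second the error of the torus average. The lower bound on N makes each hat steep enough
to fit into one period. -/
lemma Growth.integral_prod_gridTent_le {a : ℕ → ℝ} {L : ℕ} {Q : ℝ} (ha : Growth a L Q)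
    (hQ : 1 ≤ Q) {N K : ℝ} (hK : 0 ≤ K) (hN : 4 * (K + 1) ≤ N) (h : ℝ) {S : Finset ℕ}
    (hS : Separated L (fun y : S => (y : ℕ))) (T : ℝ) :
    ∫ α in T..T + 1, ∏ y ∈ S, gridTent N K h (α * a y) ≤
      2 ^ S.card * ((2 * (K + 1) * tentMass / N) ^ S.card + S.card * ((2 + S.card * N) / Q)) := by
  have hK1 : 0 < 2 * (K + 1) := by linarith
  have hN0 : 0 < N := by linarith
  set A := N / (2 * (K + 1)) with hA
  have hA2 : 2 ≤ A := by rw [hA, le_div_iff₀ hK1]; linarith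
  have hAN : A ≤ N := div_le_self hN0.le (by linarith)
  have hH := TorusLipschitz.prod (Finset.univ : Finset S)
    (H := fun y (θ : S → ℝ) => pTent A (h / N) (θ y))
    (fun y _ => TorusLipschitz.coord (by linarith) (h / N) y)
  have key := ha.abs_integral_sub_cube_le hH (by positivity) hQ hS T
  rw [integral_cube_prod_pTent hA2] at key
  simp only [Finset.card_univ, Fintype.card_coe] at key
  have e : ∀ α : ℝ, ∏ y ∈ S, gridTent N K h (α * a y)
      = 2 ^ S.card * ∏ y : S, pTent A (h / N) (α * a y) := by
    intro α
    unfold gridTent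
    rw [Finset.prod_mul_distrib, Finset.prod_const, ← Finset.prod_coe_sort S]
  simp only [e]
  rw [intervalIntegral.integral_const_mul]
  refine mul_le_mul_of_nonneg_left ?_ (by positivity)
  have e2 : tentMass / A = 2 * (K + 1) * tentMass / N := by rw [hA]; field_simp
  rw [e2] at key
  have := (abs_le.1 key).2
  have h3 : (S.card : ℝ) * ((2 * 1 + S.card * A) / Q) ≤ S.card * ((2 + S.card * N) / Q) := by
    rw [mul_one]; gcongr
  linarith

/-- Moment bound for the number of neighbours: pointwise by a continuous function with small
integral. -/
theorem exists_sum_card_ball_pow_le (K q : ℕ) : ∃ C : ℝ, 0 ≤ C ∧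
    ∀ (a : ℕ → ℝ) (N L : ℕ) (Q T : ℝ), 4 * (K + 1) ≤ N → 1 ≤ L → Growth a L Q →
    (N : ℝ) ^ (q + 2) ≤ Q → ∃ Ψ : ℝ → ℝ, Continuous Ψ ∧
      (∀ α, ∑ p ∈ Finset.Icc 1 N, ((ball a N K α p).card : ℝ) ^ q ≤ Ψ α) ∧
      ∫ α in T..T + 1, Ψ α ≤ C * N * (L : ℝ) ^ (q + 1) := by
  obtain ⟨C0, hC0⟩ : ∃ C0 : ℝ, C0 = ((2 * (q + 1)) ^ (q + 1) : ℕ) := ⟨_, rfl⟩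
  obtain ⟨C1, hC1⟩ : ∃ C1 : ℝ, C1 = (2 ^ (q + 1) * (q + 1).factorial : ℕ) := ⟨_, rfl⟩
  obtain ⟨C2, hC2⟩ : ∃ C2 : ℝ, C2 = 2 ^ (q + 1) *
    ((2 * (K + 1) * tentMass) ^ (q + 1) + (q + 1) * (2 + (q + 1))) := ⟨_, rfl⟩
  have hC0' : 0 ≤ C0 := by rw [hC0]; positivity
  have hC1' : 0 ≤ C1 := by rw [hC1]; positivity
  have hC2' : 0 ≤ C2 := by rw [hC2]; have := tentMass_nonneg; positivity
  refine ⟨2 ^ q * (1 + (C0 + C1 * C2)), by positivity, ?_⟩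
  intro a N L Q T hN hL ha hQ
  have hN1 : 1 ≤ N := by omega
  have hN1' : (1 : ℝ) ≤ N := by exact_mod_cast hN1
  have hN0 : (0 : ℝ) < N := by linarith
  have hQ1 : 1 ≤ Q := (one_le_pow₀ hN1').trans hQ
  -- Cell counts are split into the first L indices and L residue classes, which costs the powers of
  -- L. Within a class, the (q+1)-st power is bounded through (q+1)-subsets and their majorants.
  refine ⟨fun α => ∑ h ∈ Finset.range N, 2 ^ q * ((L : ℝ) ^ (q + 1) + L ^ q *
    ∑ r ∈ Finset.range L, (C0 + C1 * ∑ S ∈ (residueIndices L N r).powersetCard (q + 1),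
      ∏ y ∈ S, gridTent N K h (α * a y))), ?_, ?_, ?_⟩
  · refine continuous_finsetSum _ fun h _ => continuous_const.mul (continuous_const.add
      (continuous_const.mul (continuous_finsetSum _ fun r _ => continuous_const.add
      (continuous_const.mul (continuous_finsetSum _ fun S _ =>
        continuous_prod_gridTent a N K h S)))))
  · intro α
    have h1 : (∑ p ∈ Finset.Icc 1 N, ((ball a N K α p).card : ℝ) ^ q)
        ≤ ∑ h ∈ Finset.range N, ((cell a N K α h).card : ℝ) ^ (q + 1) := by
      exact_mod_cast sum_card_ball_pow_le a hN1 K α q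
    refine h1.trans (Finset.sum_le_sum fun h _ => ?_)
    have h2 : ((cell a N K α h).card : ℝ) ≤ L + ∑ r ∈ Finset.range L,
        (((residueIndices L N r).filter fun y =>
          dInt (α * a y - h / N) ≤ ((K : ℝ) + 1) / N).card : ℝ) := by
      have h2 : (cell a N K α h).card ≤ L + ∑ r ∈ Finset.range L,
          ((residueIndices L N r).filter fun y =>
            dInt (α * a y - h / N) ≤ ((K : ℝ) + 1) / N).card := card_filter_le_add_residue hL _
      exact_mod_cast h2
    refine (pow_le_pow_left₀ (Nat.cast_nonneg _) h2 (q + 1)).trans ?_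
    refine (add_sum_pow_le (L : ℝ) (Nat.cast_nonneg _) (fun r =>
      (((residueIndices L N r).filter fun y =>
          dInt (α * a y - h / N) ≤ ((K : ℝ) + 1) / N).card : ℝ))
      (fun r => Nat.cast_nonneg _) q).trans ?_
    gcongr with r hr
    have h3 := pow_le_add_choose (((residueIndices L N r).filter fun y =>
          dInt (α * a y - h / N) ≤ ((K : ℝ) + 1) / N).card) (q + 1)
    have h4 := choose_card_filter_le (s := residueIndices L N r)
      (p := fun y => dInt (α * a y - h / N) ≤ ((K : ℝ) + 1) / N)
      (u := fun y => gridTent N K h (α * a y)) (fun y => gridTent_nonneg _ _ _ _)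
      (fun y hy => one_le_gridTent hN0 (Nat.cast_nonneg K) hy) (q + 1)
    have h5 : ((((residueIndices L N r).filter fun y =>
          dInt (α * a y - h / N) ≤ ((K : ℝ) + 1) / N).card : ℝ)) ^ (q + 1)
        ≤ C0 + C1 * ((((residueIndices L N r).filter fun y =>
          dInt (α * a y - h / N) ≤ ((K : ℝ) + 1) / N).card.choose (q + 1) : ℕ) : ℝ) := by
      rw [hC0, hC1]; exact_mod_cast h3
    exact h5.trans (by gcongr)
  -- The hypothesis N^(q+2) ≤ Q brings the averaging error, of size O(N/Q), down to the main term
  -- N^(-(q+1)). This cancels the at most N^(q+1) choices of S.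
  · have hSint : ∀ (h : ℕ) (r : ℕ), ∀ S ∈ (residueIndices L N r).powersetCard (q + 1),
        ∫ α in T..T + 1, ∏ y ∈ S, gridTent N K h (α * a y) ≤ C2 / N ^ (q + 1) := by
      intro h r S hS
      rw [Finset.mem_powersetCard] at hS
      have := ha.integral_prod_gridTent_le hQ1 (N := N) (K := K) (Nat.cast_nonneg K)
        (by exact_mod_cast hN) h (separated_of_subset_residueIndices hS.1) T
      rw [hS.2] at this
      refine this.trans ?_
      rw [hC2, mul_div_assoc _ _ ((N : ℝ) ^ (q + 1)), add_div _ _ ((N : ℝ) ^ (q + 1)), div_pow]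
      push_cast
      gcongr
      rw [mul_div_assoc _ _ ((N : ℝ) ^ (q + 1))]
      refine mul_le_mul_of_nonneg_left ?_ (by positivity)
      rw [div_le_div_iff₀ (by linarith) (by positivity)]
      calc (2 + ((q : ℝ) + 1) * N) * N ^ (q + 1) ≤ (2 * N + ((q : ℝ) + 1) * N) * N ^ (q + 1) := by
            gcongr; linarith
        _ = (2 + (q + 1)) * N ^ (q + 2) := by ring
        _ ≤ (2 + ((q : ℝ) + 1)) * Q := by gcongr
    have hcard : ∀ r, (((residueIndices L N r).powersetCard (q + 1)).card : ℝ) ≤ N ^ (q + 1) := by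
      intro r
      rw [Finset.card_powersetCard]
      have h1 : (residueIndices L N r).card ≤ N := by
        refine (Finset.card_filter_le _ _).trans ?_
        rw [Nat.card_Ioc]; omega
      exact_mod_cast (Nat.choose_le_pow _ _).trans (Nat.pow_le_pow_left h1 _)
    have hi : ∀ (h : ℕ) (S : Finset ℕ), IntervalIntegrable
        (fun α => ∏ y ∈ S, gridTent N K h (α * a y)) volume T (T + 1) := fun h S =>
      (continuous_prod_gridTent a N K h S).intervalIntegrable _ _
    have hi2 : ∀ (h r : ℕ), IntervalIntegrable (fun α => ∑ S ∈
        (residueIndices L N r).powersetCard (q + 1), ∏ y ∈ S, gridTent N K h (α * a y))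
        volume T (T + 1) := fun h r =>
      (continuous_finsetSum _ fun S _ => continuous_prod_gridTent a N K h S).intervalIntegrable _ _
    have hi3 : ∀ (h r : ℕ), IntervalIntegrable (fun α => C0 + C1 * ∑ S ∈
        (residueIndices L N r).powersetCard (q + 1), ∏ y ∈ S, gridTent N K h (α * a y))
        volume T (T + 1) := fun h r =>
      (continuous_const.add (continuous_const.mul (continuous_finsetSum _ fun S _ =>
        continuous_prod_gridTent a N K h S))).intervalIntegrable _ _
    have hi4 : ∀ (h : ℕ), IntervalIntegrable (fun α => ∑ r ∈ Finset.range L, (C0 + C1 * ∑ S ∈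
        (residueIndices L N r).powersetCard (q + 1), ∏ y ∈ S, gridTent N K h (α * a y)))
        volume T (T + 1) := fun h =>
      (continuous_finsetSum _ fun r _ => continuous_const.add (continuous_const.mul
        (continuous_finsetSum _ fun S _ =>
        continuous_prod_gridTent a N K h S))).intervalIntegrable _ _
    have hone : ∀ h r : ℕ, ∫ α in T..T + 1, (C0 + C1 * ∑ S ∈
        (residueIndices L N r).powersetCard (q + 1), ∏ y ∈ S, gridTent N K h (α * a y))
        ≤ C0 + C1 * C2 := by
      intro h r
      rw [intervalIntegral.integral_add (by simp) ((hi2 h r).const_mul _),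
        intervalIntegral.integral_const_mul, intervalIntegral.integral_finsetSum
          (fun S _ => hi h S)]
      have : ∑ S ∈ (residueIndices L N r).powersetCard (q + 1),
          ∫ α in T..T + 1, ∏ y ∈ S, gridTent N K h (α * a y) ≤ C2 := by
        refine (Finset.sum_le_card_nsmul _ _ _ (hSint h r)).trans ?_
        rw [nsmul_eq_mul]
        calc _ ≤ (N : ℝ) ^ (q + 1) * (C2 / N ^ (q + 1)) := by gcongr; exact hcard r
          _ = C2 := by field_simp
      have := mul_le_mul_of_nonneg_left this hC1'
      simp only [intervalIntegral.integral_const, add_sub_cancel_left, one_smul]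
      linarith
    have htwo : ∀ h : ℕ, ∫ α in T..T + 1, 2 ^ q * ((L : ℝ) ^ (q + 1) + L ^ q *
        ∑ r ∈ Finset.range L, (C0 + C1 * ∑ S ∈ (residueIndices L N r).powersetCard (q + 1),
        ∏ y ∈ S, gridTent N K h (α * a y))) ≤ 2 ^ q * (1 + (C0 + C1 * C2)) * L ^ (q + 1) := by
      intro h
      rw [intervalIntegral.integral_const_mul, intervalIntegral.integral_add (by simp)
        ((hi4 h).const_mul _), intervalIntegral.integral_const_mul,
        intervalIntegral.integral_finsetSum (fun r _ => hi3 h r)]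
      simp only [intervalIntegral.integral_const, add_sub_cancel_left, one_smul]
      rw [mul_assoc]
      gcongr
      calc (L : ℝ) ^ (q + 1) + L ^ q * ∑ r ∈ Finset.range L, ∫ α in T..T + 1, (C0 + C1 * ∑ S ∈
              (residueIndices L N r).powersetCard (q + 1), ∏ y ∈ S, gridTent N K h (α * a y))
          ≤ (L : ℝ) ^ (q + 1) + L ^ q * ∑ r ∈ Finset.range L, (C0 + C1 * C2) := by
            gcongr with r hr; exact hone h r
        _ = _ := by rw [Finset.sum_const, Finset.card_range, nsmul_eq_mul]; ring
    rw [intervalIntegral.integral_finsetSum]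
    · refine (Finset.sum_le_card_nsmul _ _ _ fun h _ => htwo h).trans ?_
      rw [Finset.card_range, nsmul_eq_mul]
      exact le_of_eq (by ring)
    · intro h _
      exact (continuous_const.mul (continuous_const.add
        (continuous_const.mul (continuous_finsetSum _ fun r _ => continuous_const.add
        (continuous_const.mul (continuous_finsetSum _ fun S _ =>
        continuous_prod_gridTent a N K h S)))))).intervalIntegrable _ _

/-! ### Localization of the weights and counting of non-separated tuples -/

/-- Consecutive points are within (1 + V)/N of each other; chaining through θ₀ reaches any pair in
at most 2n steps. -/
lemma dInt_sub_le_of_diffTent_ne_zero {n : ℕ} {N M : ℝ} (hN : 0 < N) (hM : 1 ≤ M) {w : Fin n → ℝ}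
    {V : ℝ} (hw : ∀ i, |w i| ≤ V / (N * M)) {θ : Fin (n + 1) → ℝ}
    (h : diffTent (N * M) w θ ≠ 0) (i j : Fin (n + 1)) :
    dInt (θ i - θ j) ≤ 2 * n * (1 + V) / N := by
  have hA : 0 < N * M := by positivity
  have hcons : ∀ i : Fin n, dInt (θ i.castSucc - θ i.succ) ≤ (1 + V) / N := by
    intro i
    have hV : 0 ≤ V := by
      have := (abs_nonneg _).trans (hw i)
      rwa [le_div_iff₀ hA, zero_mul] at this
    have h1 := dInt_lt_of_pTent_ne_zero hA (Finset.prod_ne_zero_iff.1 h i (Finset.mem_univ i))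
    have h2 := dInt_add_le (θ i.castSucc - θ i.succ - w i) (w i)
    rw [sub_add_cancel] at h2
    calc _ ≤ 1 / (N * M) + V / (N * M) := h2.trans (add_le_add h1.le ((dInt_le_abs _).trans (hw i)))
      _ = (1 + V) / (N * M) := by ring
      _ ≤ (1 + V) / N := by gcongr; exact le_mul_of_one_le_right hN.le hM
  have h0 : ∀ j : Fin (n + 1), dInt (θ 0 - θ j) ≤ (j : ℕ) * ((1 + V) / N) := by
    intro j
    induction j using Fin.induction with
    | zero => simp [dInt_eq]
    | succ i ih =>
      refine (dInt_sub_le _ (θ i.castSucc) _).trans ?_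
      have := hcons i
      simp only [Fin.val_castSucc, Fin.val_succ, Nat.cast_add, Nat.cast_one] at ih ⊢
      linarith
  rcases Nat.eq_zero_or_pos n with rfl | hn
  · rw [show i = j from Subsingleton.elim (α := Fin 1) i j]; simp [dInt_eq]
  · have hVN : 0 ≤ (1 + V) / N := (dInt_nonneg _).trans (hcons ⟨0, hn⟩)
    have hle : ∀ j : Fin (n + 1), dInt (θ 0 - θ j) ≤ n * ((1 + V) / N) := fun j =>
      (h0 j).trans (mul_le_mul_of_nonneg_right (by exact_mod_cast Nat.le_of_lt_succ j.2) hVN)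
    have h1 := dInt_sub_le (θ i) (θ 0) (θ j)
    rw [dInt_sub_comm (θ i) (θ 0)] at h1
    have := hle i
    have := hle j
    calc _ ≤ n * ((1 + V) / N) + n * ((1 + V) / N) := by linarith
      _ = _ := by ring

/-- The extra factor N on the left avoids the exponent `Fintype.card ι - 1`; the later counts follow
the same convention. -/
lemma card_piFinset_low {ι : Type*} [Fintype ι] [DecidableEq ι] (N L : ℕ) (i : ι) :
    (Fintype.piFinset (Function.update (fun _ : ι => Finset.Icc 1 N) i (Finset.Icc 1 L))).card * N
      = L * N ^ Fintype.card ι := by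
  rw [Fintype.card_piFinset]
  have : ∀ l, (Function.update (fun _ : ι => Finset.Icc 1 N) i (Finset.Icc 1 L) l).card
      = Function.update (fun _ : ι => N) i L l := by
    intro l; by_cases h : l = i
    · subst h; simp
    · simp [h]
  simp only [this]
  rw [Finset.prod_update_of_mem (Finset.mem_univ i)]
  simp only [Finset.prod_const]
  rw [mul_assoc, ← pow_succ, Finset.card_sdiff]
  have : 0 < Fintype.card ι := Fintype.card_pos_iff.2 ⟨i⟩
  simp [Finset.card_univ, Nat.sub_add_cancel this]

/-- Replacing z_j by z_i + L - z_j is injective, and closeness puts the new entry in [1, 2L], which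
reduces the count to `card_piFinset_low`. -/
lemma card_close_coords_le {ι : Type*} [Fintype ι] [DecidableEq ι] (N L : ℕ) {i j : ι}
    (hij : i ≠ j) :
    ((Fintype.piFinset fun _ : ι => Finset.Icc 1 N).filter
      fun z => z i < z j + L ∧ z j < z i + L).card * N ≤ 2 * L * N ^ Fintype.card ι := by
  rw [← card_piFinset_low N (2 * L) j]
  refine Nat.mul_le_mul_right _ ?_
  refine Finset.card_le_card_of_injOn (fun z => Function.update z j (z i + L - z j)) ?_ ?_
  · intro z hz
    simp only [Finset.coe_filter, Set.mem_ofPred_eq, Fintype.mem_piFinset, Finset.mem_Icc] at hz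
    simp only [Finset.mem_coe, Fintype.mem_piFinset]
    intro l
    by_cases h : l = j
    · subst h
      simp only [Function.update_self, Finset.mem_Icc]
      omega
    · simp only [Function.update_of_ne h, Finset.mem_Icc]
      exact hz.1 l
  · intro z hz z' hz' h
    simp only [Finset.coe_filter, Set.mem_ofPred_eq] at hz hz'
    have hne : ∀ l, l ≠ j → z l = z' l := by
      intro l hl
      have := congrFun h l
      simpa [Function.update_of_ne hl] using this
    have hj := congrFun h j
    simp only [Function.update_self] at hj
    have hi := hne i hij
    funext l
    by_cases hl : l = j
    · subst hl; omega
    · exact hne l hl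

open Classical in
lemma card_not_separated_le {ι : Type*} [Fintype ι] [DecidableEq ι] (N L : ℕ) :
    ((Fintype.piFinset fun _ : ι => Finset.Icc 1 N).filter fun z => ¬Separated L z).card * N
      ≤ 3 * Fintype.card ι ^ 2 * L * N ^ Fintype.card ι := by
  have hsub : ((Fintype.piFinset fun _ : ι => Finset.Icc 1 N).filter fun z => ¬Separated L z) ⊆
      (Finset.univ.biUnion fun i : ι => Fintype.piFinset
        (Function.update (fun _ : ι => Finset.Icc 1 N) i (Finset.Icc 1 L))) ∪
      ((Finset.univ : Finset (ι × ι)).filter fun p => p.1 ≠ p.2).biUnion fun p =>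
        (Fintype.piFinset fun _ : ι => Finset.Icc 1 N).filter
          fun z => z p.1 < z p.2 + L ∧ z p.2 < z p.1 + L := by
    intro z hz
    rw [Finset.mem_filter, Fintype.mem_piFinset] at hz
    obtain ⟨hz1, hz2⟩ := hz
    rw [Separated, not_and_or] at hz2
    rw [Finset.mem_union, Finset.mem_biUnion, Finset.mem_biUnion]
    rcases hz2 with h | h
    · push Not at h
      obtain ⟨i, hi⟩ := h
      refine Or.inl ⟨i, Finset.mem_univ i, ?_⟩
      rw [Fintype.mem_piFinset]
      intro l
      by_cases hl : l = i
      · subst hl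
        rw [Function.update_self, Finset.mem_Icc]
        exact ⟨(Finset.mem_Icc.1 (hz1 l)).1, hi⟩
      · rw [Function.update_of_ne hl]; exact hz1 l
    · push Not at h
      obtain ⟨i, j, hij, h1, h2⟩ := h
      refine Or.inr ⟨(i, j), by simp [hij], ?_⟩
      rw [Finset.mem_filter, Fintype.mem_piFinset]
      exact ⟨hz1, h2, h1⟩
  set d := Fintype.card ι with hd
  have h1 : (Finset.univ.biUnion fun i : ι => Fintype.piFinset
        (Function.update (fun _ : ι => Finset.Icc 1 N) i (Finset.Icc 1 L))).card * N
      ≤ d * (L * N ^ d) := by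
    refine (Nat.mul_le_mul_right _ Finset.card_biUnion_le).trans ?_
    rw [Finset.sum_mul]
    refine (Finset.sum_le_card_nsmul _ _ (L * N ^ d) fun i _ => ?_).trans_eq ?_
    · exact (card_piFinset_low N L i).le
    · rw [smul_eq_mul, Finset.card_univ]
  have h2 : (((Finset.univ : Finset (ι × ι)).filter fun p => p.1 ≠ p.2).biUnion fun p =>
        (Fintype.piFinset fun _ : ι => Finset.Icc 1 N).filter
          fun z => z p.1 < z p.2 + L ∧ z p.2 < z p.1 + L).card * N
      ≤ d ^ 2 * (2 * L * N ^ d) := by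
    refine (Nat.mul_le_mul_right _ Finset.card_biUnion_le).trans ?_
    rw [Finset.sum_mul]
    refine (Finset.sum_le_card_nsmul _ _ (2 * L * N ^ d) fun p hp => ?_).trans ?_
    · exact card_close_coords_le N L (Finset.mem_filter.1 hp).2
    · rw [smul_eq_mul]
      refine Nat.mul_le_mul_right _ ((Finset.card_filter_le _ _).trans ?_)
      rw [Finset.card_univ, Fintype.card_prod, sq]
  calc _ ≤ (_ + _) * N := Nat.mul_le_mul_right _
        ((Finset.card_le_card hsub).trans (Finset.card_union_le _ _))
    _ ≤ d * (L * N ^ d) + d ^ 2 * (2 * L * N ^ d) := by rw [add_mul]; exact add_le_add h1 h2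
    _ ≤ d ^ 2 * (L * N ^ d) + d ^ 2 * (2 * L * N ^ d) := by
        gcongr; exact Nat.le_self_pow two_ne_zero d
    _ = _ := by ring

/-- Pairs of indices up to `N` that differ by less than `L`. -/
def closePairs (N L : ℕ) : Finset (ℕ × ℕ) :=
  (Finset.Icc 1 N ×ˢ Finset.Icc 1 N).filter fun z => z.1 < z.2 + L ∧ z.2 < z.1 + L

lemma card_close_le (s : Finset ℕ) (L p : ℕ) :
    (s.filter fun y => p < y + L ∧ y < p + L).card ≤ 2 * L := by
  have : (s.filter fun y => p < y + L ∧ y < p + L) ⊆ Finset.Ico (p + 1 - L) (p + L) := by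
    intro y hy
    rw [Finset.mem_filter] at hy
    rw [Finset.mem_Ico]; omega
  refine (Finset.card_le_card this).trans ?_
  rw [Nat.card_Ico]; omega

lemma sum_closePairs_fst_le (N L : ℕ) {g : ℕ → ℝ} (hg : ∀ p, 0 ≤ g p) :
    ∑ z ∈ closePairs N L, g z.1 ≤ 2 * L * ∑ p ∈ Finset.Icc 1 N, g p := by
  rw [closePairs, Finset.sum_filter, Finset.sum_product, Finset.mul_sum]
  refine Finset.sum_le_sum fun p _ => ?_
  rw [← Finset.sum_filter]
  simp only
  rw [Finset.sum_const, nsmul_eq_mul]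
  exact mul_le_mul_of_nonneg_right (by exact_mod_cast card_close_le _ L p) (hg p)

lemma sum_closePairs_snd_le (N L : ℕ) {g : ℕ → ℝ} (hg : ∀ p, 0 ≤ g p) :
    ∑ z ∈ closePairs N L, g z.2 ≤ 2 * L * ∑ p ∈ Finset.Icc 1 N, g p := by
  have : ∑ z ∈ closePairs N L, g z.2 = ∑ z ∈ closePairs N L, g z.1 := by
    refine Finset.sum_bij' (fun z _ => z.swap) (fun z _ => z.swap) ?_ ?_ ?_ ?_ ?_ <;>
      simp +contextual [closePairs]
  rw [this]; exact sum_closePairs_fst_le N L hg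

open Classical in
/-- The tuples with separated entries in `{1, …, N}`. -/
noncomputable def separatedTuples (k N L : ℕ) : Finset (Fin k → ℕ) :=
  (Fintype.piFinset fun _ : Fin k => Finset.Icc 1 N).filter fun x => Separated L x

/-- The periodized test function at the differences of `(α a_{x_1}, …, α a_{x_{n+1}})`. -/
noncomputable def tupleWeight {n : ℕ} (a : ℕ → ℝ) (N M : ℕ) (v : Fin n → ℤ) (α : ℝ)
    (x : Fin (n + 1) → ℕ) : ℝ :=
  diffTent ((N : ℝ) * M) (fun i => v i / ((N : ℝ) * M)) fun i => α * a (x i)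

section tupleWeight

variable {n : ℕ} (a : ℕ → ℝ) (N M : ℕ) (v : Fin n → ℤ) (α : ℝ) (x : Fin (n + 1) → ℕ)

lemma tupleWeight_nonneg : 0 ≤ tupleWeight a N M v α x := diffTent_nonneg _ _ _

lemma tupleWeight_le_one : tupleWeight a N M v α x ≤ 1 := diffTent_le_one (by positivity) _ _

lemma continuous_tupleWeight : Continuous fun α => tupleWeight a N M v α x :=
  (torusLipschitz_diffTent (A := (N : ℝ) * M) (by positivity) _).continuous.comp (by fun_prop)

/-- A radius `K` such that the test function vanishes unless all points are `K / N`-close. -/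
def tentRadius {n : ℕ} (v : Fin n → ℤ) : ℕ := 2 * n * (1 + ∑ i, (v i).natAbs)

variable {a N M v α x}

lemma mem_piFinset_ball_of_tupleWeight_ne_zero (hN : 1 ≤ N) (hM : 1 ≤ M)
    (hx : x ∈ Fintype.piFinset fun _ : Fin (n + 1) => Finset.Icc 1 N)
    (h : tupleWeight a N M v α x ≠ 0) (i : Fin (n + 1)) :
    x ∈ Fintype.piFinset fun _ : Fin (n + 1) => ball a N (tentRadius v) α (x i) := by
  rw [Fintype.mem_piFinset] at hx ⊢
  intro j
  rw [ball, Finset.mem_filter]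
  refine ⟨hx j, ?_⟩
  have hN' : (0 : ℝ) < N := by exact_mod_cast hN
  have hM' : (1 : ℝ) ≤ M := by exact_mod_cast hM
  have := dInt_sub_le_of_diffTent_ne_zero hN' hM' (V := ((∑ i, (v i).natAbs : ℕ) : ℝ))
    (fun i => by
      rw [abs_div, abs_of_pos (show (0 : ℝ) < N * M by positivity)]
      gcongr
      have h1 : (v i).natAbs ≤ ∑ i, (v i).natAbs :=
        Finset.single_le_sum (f := fun i => (v i).natAbs) (fun _ _ => Nat.zero_le _)
          (Finset.mem_univ i)
      calc |(v i : ℝ)| = ((v i).natAbs : ℝ) := by rw [Nat.cast_natAbs, Int.cast_abs]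
        _ ≤ _ := by exact_mod_cast h1) h j i
  convert this using 2
  rw [tentRadius]; push_cast; ring

end tupleWeight

open Classical in
/-- Pairs of separated tuples that are not jointly separated. -/
noncomputable def entangledPairs (k N L : ℕ) : Finset ((Fin k → ℕ) × (Fin k → ℕ)) :=
  (separatedTuples k N L ×ˢ separatedTuples k N L).filter fun z => ¬Separated L (Sum.elim z.1 z.2)

lemma card_entangledPairs_le (k N L : ℕ) :
    (entangledPairs k N L).card * N ≤ 3 * (2 * k) ^ 2 * L * N ^ (2 * k) := by
  classical
  have h := card_not_separated_le (ι := Fin k ⊕ Fin k) N L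
  simp only [Fintype.card_sum, Fintype.card_fin, ← two_mul] at h
  refine le_trans (Nat.mul_le_mul_right _ ?_) h
  refine Finset.card_le_card_of_injOn (fun z => Sum.elim z.1 z.2) ?_ ?_
  · intro z hz
    simp only [entangledPairs, separatedTuples, Finset.coe_filter, Set.mem_ofPred_eq,
      Finset.mem_product, Finset.mem_filter, Fintype.mem_piFinset] at hz ⊢
    refine ⟨?_, hz.2⟩
    rintro (i | i)
    · exact hz.1.1.1 i
    · exact hz.1.2.1 i
  · intro z _ z' _ h
    exact Prod.ext (funext fun i => congrFun h (Sum.inl i)) (funext fun i => congrFun h (Sum.inr i))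

lemma exists_close_of_mem_entangledPairs {k N L : ℕ} {z : (Fin k → ℕ) × (Fin k → ℕ)}
    (hz : z ∈ entangledPairs k N L) : ∃ i j, (z.1 i, z.2 j) ∈ closePairs N L := by
  classical
  simp only [entangledPairs, separatedTuples, Finset.mem_product, Finset.mem_filter,
    Fintype.mem_piFinset] at hz
  obtain ⟨⟨⟨h1, s1⟩, h2, s2⟩, h⟩ := hz
  by_contra hc
  push Not at hc
  have hc' : ∀ i j, z.1 i + L ≤ z.2 j ∨ z.2 j + L ≤ z.1 i := by
    intro i j
    have := hc i j
    simp only [closePairs, Finset.mem_filter, Finset.mem_product, h1 i, h2 j, true_and] at this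
    omega
  apply h
  refine ⟨?_, ?_⟩
  · rintro (i | i)
    · exact s1.1 i
    · exact s2.1 i
  · rintro (i | i) (j | j) hij
    · exact s1.2 i j (fun h => hij (by rw [h]))
    · exact hc' i j
    · exact (hc' j i).symm
    · exact s2.2 i j (fun h => hij (by rw [h]))

/-- An entangled pair of nonzero weight has close indices p, q in its two tuples, and each tuple
lies in the ball around its own one. There are at most m_p^(n+1) m_q^(n+1) such pairs; the
arithmetic-geometric mean inequality decouples p from q, and each index has at most 2L close
partners. -/
lemma sum_entangledPairs_le {n : ℕ} (a : ℕ → ℝ) {N M : ℕ} (hN : 1 ≤ N) (hM : 1 ≤ M) (L : ℕ)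
    (v : Fin n → ℤ) (α : ℝ) :
    ∑ z ∈ entangledPairs (n + 1) N L, tupleWeight a N M v α z.1 * tupleWeight a N M v α z.2
      ≤ 2 * L * ∑ p ∈ Finset.Icc 1 N, ((ball a N (tentRadius v) α p).card : ℝ) ^ (2 * (n + 1)) := by
  classical
  set m : ℕ → ℝ := fun p => (ball a N (tentRadius v) α p).card with hm
  set P := fun p : ℕ => Fintype.piFinset fun _ : Fin (n + 1) => ball a N (tentRadius v) α p
  set s := (entangledPairs (n + 1) N L).filter fun z =>
    tupleWeight a N M v α z.1 * tupleWeight a N M v α z.2 ≠ 0 with hs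
  have h1 : ∑ z ∈ entangledPairs (n + 1) N L,
      tupleWeight a N M v α z.1 * tupleWeight a N M v α z.2 ≤ s.card := by
    rw [← Finset.sum_filter_ne_zero, Finset.card_eq_sum_ones, Nat.cast_sum]
    refine Finset.sum_le_sum fun z _ => ?_
    rw [Nat.cast_one]
    exact mul_le_one₀ (tupleWeight_le_one _ _ _ _ _ _) (tupleWeight_nonneg _ _ _ _ _ _)
      (tupleWeight_le_one _ _ _ _ _ _)
  have h2 : s ⊆ (closePairs N L).biUnion fun q => P q.1 ×ˢ P q.2 := by
    intro z hz
    rw [hs, Finset.mem_filter] at hz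
    obtain ⟨i, j, hij⟩ := exists_close_of_mem_entangledPairs hz.1
    rw [Finset.mem_biUnion]
    refine ⟨_, hij, ?_⟩
    have hz1 := hz.1
    simp only [entangledPairs, separatedTuples, Finset.mem_product, Finset.mem_filter] at hz1
    rw [Finset.mem_product]
    exact ⟨mem_piFinset_ball_of_tupleWeight_ne_zero hN hM hz1.1.1.1 (left_ne_zero_of_mul hz.2) i,
      mem_piFinset_ball_of_tupleWeight_ne_zero hN hM hz1.1.2.1 (right_ne_zero_of_mul hz.2) j⟩
  have h3 : (s.card : ℝ) ≤ ∑ q ∈ closePairs N L, m q.1 ^ (n + 1) * m q.2 ^ (n + 1) := by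
    have : s.card ≤ ∑ q ∈ closePairs N L, (ball a N (tentRadius v) α q.1).card ^ (n + 1) *
        (ball a N (tentRadius v) α q.2).card ^ (n + 1) := by
      refine (Finset.card_le_card h2).trans (Finset.card_biUnion_le.trans_eq ?_)
      refine Finset.sum_congr rfl fun q _ => ?_
      rw [Finset.card_product, Fintype.card_piFinset, Fintype.card_piFinset]
      simp
    simp only [hm]
    exact_mod_cast this
  have h4 : ∑ q ∈ closePairs N L, m q.1 ^ (n + 1) * m q.2 ^ (n + 1)
      ≤ ∑ q ∈ closePairs N L, (m q.1 ^ (2 * (n + 1)) + m q.2 ^ (2 * (n + 1))) / 2 := by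
    refine Finset.sum_le_sum fun q _ => ?_
    have := sq_nonneg (m q.1 ^ (n + 1) - m q.2 ^ (n + 1))
    rw [pow_mul', pow_mul']
    linarith
  have h5 : ∑ q ∈ closePairs N L, (m q.1 ^ (2 * (n + 1)) + m q.2 ^ (2 * (n + 1))) / 2
      ≤ 2 * L * ∑ p ∈ Finset.Icc 1 N, m p ^ (2 * (n + 1)) := by
    rw [← Finset.sum_div, Finset.sum_add_distrib]
    have hnn : ∀ p, 0 ≤ m p ^ (2 * (n + 1)) := fun p => by positivity
    have e1 := sum_closePairs_fst_le N L (g := fun p => m p ^ (2 * (n + 1))) hnn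
    have e2 := sum_closePairs_snd_le N L (g := fun p => m p ^ (2 * (n + 1))) hnn
    linarith
  linarith

/-! ### Second moment over separated tuples -/

/-- On the torus the two centred factors depend on disjoint coordinates, so their product has mean
zero. Only the averaging error over 2(n + 1) frequencies remains. -/
lemma Growth.integral_joint_le {a : ℕ → ℝ} {L : ℕ} {Q : ℝ} (ha : Growth a L Q) (hQ : 1 ≤ Q)
    {n : ℕ} {N M : ℕ} (hNM : 2 ≤ N * M) (v : Fin n → ℤ) {x x' : Fin (n + 1) → ℕ}
    (hx : Separated L (Sum.elim x x')) (T : ℝ) :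
    ∫ α in T..T + 1, (tupleWeight a N M v α x - (tentMass / (N * M)) ^ n) *
        (tupleWeight a N M v α x' - (tentMass / (N * M)) ^ n)
      ≤ (2 * (n + 1)) * ((2 + 2 * (n * (2 * (N * M)))) / Q) := by
  have hA : (2 : ℝ) ≤ N * M := by exact_mod_cast hNM
  have hA0 : (0 : ℝ) ≤ N * M := by linarith
  set w : Fin n → ℝ := fun i => v i / ((N : ℝ) * M)
  set μ := (tentMass / ((N : ℝ) * M)) ^ n with hμ
  have hμ0 : 0 ≤ μ := by have := tentMass_nonneg; positivity
  have hμ1 : μ ≤ 1 := by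
    have h1 : tentMass / ((N : ℝ) * M) ≤ 1 := by
      rw [← integral_pTent hA 0]
      have := abs_intervalIntegral_unit_le (f := pTent ((N : ℝ) * M) 0) (C := 1) 0 (fun t => by
        rw [abs_of_nonneg (pTent_nonneg _ _ _)]; exact pTent_le_one hA0 _ _)
      rw [zero_add] at this
      exact (le_abs_self _).trans this
    exact pow_le_one₀ (by have := tentMass_nonneg; positivity) h1
  have hG := (torusLipschitz_diffTent hA0 w).sub_const (diffTent_nonneg _ _) hμ0 hμ1
  have hΛ : (0 : ℝ) ≤ n * (2 * (N * M)) := by positivity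
  have hH := (hG.comp hΛ (Sum.inl : Fin (n + 1) → Fin (n + 1) ⊕ Fin (n + 1))).mul
    (hG.comp hΛ (Sum.inr : Fin (n + 1) → Fin (n + 1) ⊕ Fin (n + 1)))
  have key := ha.abs_integral_sub_cube_le hH (by positivity) hQ hx T
  have h0 : ∫ θ, (diffTent ((N : ℝ) * M) w θ - μ) ∂(cubeMeasure (Fin (n + 1))) = 0 := by
    rw [integral_sub, integral_diffTent hA]
    · simp [hμ]
    · exact Integrable.of_bound (torusLipschitz_diffTent hA0 w).continuous.aestronglyMeasurable 1
        (Filter.Eventually.of_forall fun θ => (torusLipschitz_diffTent hA0 w).bound θ)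
    · exact integrable_const _
  rw [integral_cube_sum_mul (fun θ => diffTent ((N : ℝ) * M) w θ - μ)
    (fun θ => diffTent ((N : ℝ) * M) w θ - μ), h0, zero_mul, sub_zero] at key
  refine (le_abs_self _).trans (key.trans_eq ?_)
  rw [Fintype.card_sum, Fintype.card_fin]
  push_cast
  ring

lemma sum_sq_eq_sum_joint_add_entangled {k N L : ℕ} (u : (Fin k → ℕ) → ℝ) [DecidablePred
    fun z : (Fin k → ℕ) × (Fin k → ℕ) => Separated L (Sum.elim z.1 z.2)] :
    (∑ x ∈ separatedTuples k N L, u x) ^ 2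
      = ∑ z ∈ (separatedTuples k N L ×ˢ separatedTuples k N L).filter
          (fun z => Separated L (Sum.elim z.1 z.2)), u z.1 * u z.2
        + ∑ z ∈ entangledPairs k N L, u z.1 * u z.2 := by
  rw [sq, Finset.sum_mul_sum, ← Finset.sum_product' (f := fun x y => u x * u y),
    ← Finset.sum_filter_add_sum_filter_not _
      (fun z : (Fin k → ℕ) × (Fin k → ℕ) => Separated L (Sum.elim z.1 z.2))]
  congr 1
  refine Finset.sum_congr ?_ fun _ _ => rfl
  unfold entangledPairs
  congr

lemma card_separatedTuples_le (k N L : ℕ) : (separatedTuples k N L).card ≤ N ^ k := by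
  classical
  unfold separatedTuples
  refine (Finset.card_filter_le _ _).trans ?_
  rw [Fintype.card_piFinset]
  simp

lemma intervalIntegral_add_of_continuous {f g : ℝ → ℝ} (hf : Continuous f) (hg : Continuous g)
    (b c : ℝ) : ∫ x in b..c, (f x + g x) = (∫ x in b..c, f x) + ∫ x in b..c, g x :=
  intervalIntegral.integral_add (hf.intervalIntegrable _ _) (hg.intervalIntegrable _ _)

lemma intervalIntegral_sum_of_continuous {σ : Type*} (s : Finset σ) {f : σ → ℝ → ℝ}
    (hf : ∀ i, Continuous (f i)) (b c : ℝ) :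
    ∫ x in b..c, ∑ i ∈ s, f i x = ∑ i ∈ s, ∫ x in b..c, f i x :=
  intervalIntegral.integral_finsetSum fun i _ => (hf i).intervalIntegrable _ _

/-- Second moment of the deviation of the sum over separated tuples from its mean. -/
theorem exists_integral_sq_separated_le {n : ℕ} (v : Fin n → ℤ) {M : ℕ} (hM : 1 ≤ M) :
    ∃ C : ℝ, 0 ≤ C ∧ ∀ (a : ℕ → ℝ) (N L : ℕ) (Q T : ℝ), 4 * (tentRadius v + 1) ≤ N → 1 ≤ L →
    Growth a L Q → (N : ℝ) ^ (2 * (n + 1) + 2) ≤ Q →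
    ∫ α in T..T + 1, (∑ x ∈ separatedTuples (n + 1) N L,
        (tupleWeight a N M v α x - (tentMass / (N * M)) ^ n)) ^ 2
      ≤ C * N * (L : ℝ) ^ (2 * (n + 1) + 2) := by
  classical
  obtain ⟨C1, hC1, hmom⟩ := exists_sum_card_ball_pow_le (tentRadius v) (2 * (n + 1))
  have hJ := tentMass_nonneg
  obtain ⟨Cj, hCj⟩ : ∃ Cj : ℝ, Cj = 2 * (n + 1) * (2 + 2 * (n * (2 * M))) := ⟨_, rfl⟩
  obtain ⟨Ce, hCe⟩ : ∃ Ce : ℝ, Ce = 3 * (2 * (n + 1)) ^ 2 * tentMass ^ (2 * n) := ⟨_, rfl⟩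
  have hCj0 : 0 ≤ Cj := by rw [hCj]; positivity
  have hCe0 : 0 ≤ Ce := by rw [hCe]; positivity
  refine ⟨Cj + 2 * C1 + Ce, by positivity, ?_⟩
  intro a N L Q T hN hL ha hQ
  have hN1 : 1 ≤ N := by omega
  have hN1' : (1 : ℝ) ≤ N := by exact_mod_cast hN1
  have hL1' : (1 : ℝ) ≤ L := by exact_mod_cast hL
  have hM1' : (1 : ℝ) ≤ M := by exact_mod_cast hM
  have hN0 : (0 : ℝ) < N := by linarith
  have hQ1 : 1 ≤ Q := (one_le_pow₀ hN1').trans hQ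
  have hNM : 2 ≤ N * M := le_trans (by omega : 2 ≤ N) (Nat.le_mul_of_pos_right N hM)
  obtain ⟨Ψ, hΨc, hΨ, hΨi⟩ := hmom a N L Q T hN hL ha hQ
  set μ : ℝ := (tentMass / (N * M)) ^ n with hμ
  have hμ0 : 0 ≤ μ := by positivity
  set u := fun (α : ℝ) (x : Fin (n + 1) → ℕ) => tupleWeight a N M v α x - μ with hu
  have hcu : ∀ x, Continuous fun α => u α x := fun x =>
    (continuous_tupleWeight a N M v x).sub continuous_const
  set J := (separatedTuples (n + 1) N L ×ˢ separatedTuples (n + 1) N L).filter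
          (fun z => Separated L (Sum.elim z.1 z.2)) with hJdef
  set E := entangledPairs (n + 1) N L
  -- On entangled pairs the cross terms -μ(w + w') are nonpositive and are dropped.
  have hpt : ∀ α, (∑ x ∈ separatedTuples (n + 1) N L, u α x) ^ 2
      ≤ ∑ z ∈ J, u α z.1 * u α z.2 + (2 * L * Ψ α + E.card * μ ^ 2) := by
    intro α
    rw [sum_sq_eq_sum_joint_add_entangled]
    refine add_le_add le_rfl ?_
    calc ∑ z ∈ E, u α z.1 * u α z.2
        ≤ ∑ z ∈ E, (tupleWeight a N M v α z.1 * tupleWeight a N M v α z.2 + μ ^ 2) := by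
          refine Finset.sum_le_sum fun z _ => ?_
          have h1 := tupleWeight_nonneg a N M v α z.1
          have h2 := tupleWeight_nonneg a N M v α z.2
          have := mul_nonneg hμ0 h1
          have := mul_nonneg hμ0 h2
          simp only [hu]
          nlinarith
      _ ≤ _ := by
          rw [Finset.sum_add_distrib, Finset.sum_const, nsmul_eq_mul]
          have h1 := sum_entangledPairs_le a hN1 hM L v α
          have h2 := mul_le_mul_of_nonneg_left (hΨ α) (show (0 : ℝ) ≤ 2 * L by positivity)
          linarith
  have hcJ : Continuous fun α => ∑ z ∈ J, u α z.1 * u α z.2 :=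
    continuous_finsetSum _ fun z _ => (hcu _).mul (hcu _)
  have hc2 : Continuous fun α => 2 * L * Ψ α + E.card * μ ^ 2 := by fun_prop
  have hcL : Continuous fun α => (∑ x ∈ separatedTuples (n + 1) N L, u α x) ^ 2 :=
    (continuous_finsetSum _ fun x _ => hcu x).pow 2
  -- At most N^(2(n+1)) pairs, each contributing O(N/Q); the lower bound on Q makes the total
  -- bounded.
  have hJint : ∫ α in T..T + 1, ∑ z ∈ J, u α z.1 * u α z.2 ≤ Cj := by
    rw [intervalIntegral_sum_of_continuous J (f := fun z α => u α z.1 * u α z.2)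
      fun z => (hcu _).mul (hcu _)]
    refine (Finset.sum_le_card_nsmul _ _
      ((2 * (n + 1)) * ((2 + 2 * (n * (2 * (N * M)))) / Q)) fun z hz => ?_).trans ?_
    · rw [hJdef, Finset.mem_filter] at hz
      exact ha.integral_joint_le hQ1 hNM v hz.2 T
    · have hc : (J.card : ℝ) ≤ N ^ (2 * (n + 1)) := by
        have : J.card ≤ N ^ (2 * (n + 1)) := by
          refine (Finset.card_filter_le _ _).trans ?_
          rw [Finset.card_product, two_mul, pow_add]
          exact Nat.mul_le_mul (card_separatedTuples_le _ _ _) (card_separatedTuples_le _ _ _)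
        exact_mod_cast this
      rw [nsmul_eq_mul, mul_div_assoc', mul_div_assoc', div_le_iff₀ (by linarith)]
      calc (J.card : ℝ) * (2 * (n + 1) * (2 + 2 * (n * (2 * (N * M)))))
          ≤ N ^ (2 * (n + 1)) * (2 * (n + 1) * (2 * N + 2 * (n * (2 * (N * M))))) := by
            gcongr; linarith
        _ = Cj * N ^ (2 * (n + 1) + 1) := by rw [hCj]; ring
        _ ≤ Cj * N ^ (2 * (n + 1) + 2) := by gcongr <;> first | exact hN1' | omega
        _ ≤ Cj * Q := by gcongr
  -- There are O(L N^(2n+1)) entangled pairs, while μ² = O(N^(-2n)).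
  have hEint : (E.card : ℝ) * μ ^ 2 ≤ Ce * N * L := by
    have h1 : (E.card : ℝ) * N ≤ 3 * (2 * (n + 1)) ^ 2 * L * N ^ (2 * (n + 1)) := by
      exact_mod_cast card_entangledPairs_le (n + 1) N L
    have h2 : μ ^ 2 ≤ tentMass ^ (2 * n) / N ^ (2 * n) := by
      rw [hμ, ← pow_mul, mul_comm n 2, ← div_pow]
      gcongr
      exact le_mul_of_one_le_right hN0.le hM1'
    have h3 : (E.card : ℝ) ≤ 3 * (2 * (n + 1)) ^ 2 * L * N ^ (2 * n + 1) := by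
      have : (E.card : ℝ) * N ≤ 3 * (2 * (n + 1)) ^ 2 * L * N ^ (2 * n + 1) * N :=
        h1.trans_eq (by ring)
      exact le_of_mul_le_mul_right this hN0
    calc (E.card : ℝ) * μ ^ 2
        ≤ (3 * (2 * (n + 1)) ^ 2 * L * N ^ (2 * n + 1)) * (tentMass ^ (2 * n) / N ^ (2 * n)) := by
          gcongr
      _ = Ce * N * L := by rw [hCe]; field_simp; ring
  have hLp : (L : ℝ) ≤ L ^ (2 * (n + 1) + 2) := le_self_pow₀ hL1' (by omega)
  have hLp1 : (1 : ℝ) ≤ L ^ (2 * (n + 1) + 2) := one_le_pow₀ hL1'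
  calc _ ≤ ∫ α in T..T + 1, (∑ z ∈ J, u α z.1 * u α z.2 + (2 * L * Ψ α + E.card * μ ^ 2)) :=
        intervalIntegral.integral_mono_on (by linarith) (hcL.intervalIntegrable _ _)
          ((hcJ.add hc2).intervalIntegrable _ _) fun α _ => hpt α
    _ = (∫ α in T..T + 1, ∑ z ∈ J, u α z.1 * u α z.2) + (2 * L * (∫ α in T..T + 1, Ψ α)
        + E.card * μ ^ 2) := by
        rw [intervalIntegral_add_of_continuous hcJ hc2, intervalIntegral_add_of_continuous
          (f := fun α => 2 * L * Ψ α) (continuous_const.mul hΨc) continuous_const,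
          intervalIntegral.integral_const_mul]
        simp
    _ ≤ Cj + (2 * L * (C1 * N * (L : ℝ) ^ (2 * (n + 1) + 1)) + Ce * N * L) := by gcongr
    _ ≤ Cj * N * L ^ (2 * (n + 1) + 2) + (2 * C1 * N * L ^ (2 * (n + 1) + 2)
        + Ce * N * L ^ (2 * (n + 1) + 2)) := by
        refine add_le_add ?_ (add_le_add (le_of_eq (by ring)) (by gcongr))
        rw [mul_assoc]
        refine le_mul_of_one_le_right hCj0 ?_
        nlinarith
    _ = _ := by ring

/-! ### First moment over crowded tuples -/

open Classical in
/-- Tuples with distinct entries that are not separated. -/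
noncomputable def crowdedTuples (k N L : ℕ) : Finset (Fin k → ℕ) :=
  (distinctTuples k N).filter fun x => ¬Separated L x

/-- A crowded tuple has an entry at most L, or two distinct entries beyond L at index distance less
than L. If its weight is nonzero it lies in the ball around such an entry, and in the second case
the two points are also K/N-close modulo 1. Keeping that last condition saves a factor N on average.
-/
lemma sum_crowdedTuples_le {n : ℕ} (a : ℕ → ℝ) {N M L : ℕ} (hN : 1 ≤ N) (hM : 1 ≤ M)
    (v : Fin n → ℤ) (α : ℝ) :
    ∑ x ∈ crowdedTuples (n + 1) N L, tupleWeight a N M v α x ≤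
      ∑ p ∈ Finset.Icc 1 (min L N), ((ball a N (tentRadius v) α p).card : ℝ) ^ (n + 1) +
      ∑ z ∈ (closePairs N L).filter (fun z => L < z.2 ∧ z.2 < z.1 ∧
        dInt (α * a z.2 - α * a z.1) ≤ (tentRadius v : ℝ) / N),
        ((ball a N (tentRadius v) α z.1).card : ℝ) ^ (n + 1) := by
  classical
  set P := fun p : ℕ => Fintype.piFinset fun _ : Fin (n + 1) => ball a N (tentRadius v) α p with hP
  set s := (crowdedTuples (n + 1) N L).filter fun x => tupleWeight a N M v α x ≠ 0 with hs
  set Z := (closePairs N L).filter (fun z => L < z.2 ∧ z.2 < z.1 ∧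
        dInt (α * a z.2 - α * a z.1) ≤ (tentRadius v : ℝ) / N) with hZ
  have h1 : ∑ x ∈ crowdedTuples (n + 1) N L, tupleWeight a N M v α x ≤ s.card := by
    rw [← Finset.sum_filter_ne_zero, Finset.card_eq_sum_ones, Nat.cast_sum]
    refine Finset.sum_le_sum fun z _ => ?_
    rw [Nat.cast_one]
    exact tupleWeight_le_one _ _ _ _ _ _
  have h2 : s ⊆ (Finset.Icc 1 (min L N)).biUnion P ∪ Z.biUnion fun z => P z.1 := by
    intro x hx
    rw [hs, Finset.mem_filter, crowdedTuples, Finset.mem_filter, distinctTuples,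
      Finset.mem_filter] at hx
    obtain ⟨⟨⟨hx1, hinj⟩, hsep⟩, hne⟩ := hx
    have hball := mem_piFinset_ball_of_tupleWeight_ne_zero hN hM hx1 hne
    rw [Fintype.mem_piFinset] at hx1
    rw [Finset.mem_union, Finset.mem_biUnion, Finset.mem_biUnion]
    by_cases hlow : ∀ i, L < x i
    · right
      have : ∃ i j, x j < x i ∧ x i < x j + L := by
        by_contra hc
        push Not at hc
        refine hsep ⟨hlow, fun i j hij => ?_⟩
        rcases lt_or_gt_of_ne (fun h => hij (hinj h) : x i ≠ x j) with h | h
        · exact Or.inl (hc j i h)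
        · exact Or.inr (hc i j h)
      obtain ⟨i, j, h1, h2⟩ := this
      refine ⟨(x i, x j), ?_, hball i⟩
      have hb := Fintype.mem_piFinset.1 (hball i) j
      rw [ball, Finset.mem_filter] at hb
      rw [hZ, Finset.mem_filter, closePairs, Finset.mem_filter, Finset.mem_product]
      exact ⟨⟨⟨hx1 i, hx1 j⟩, h2, by simp only; omega⟩, hlow j, h1, hb.2⟩
    · left
      push Not at hlow
      obtain ⟨i, hi⟩ := hlow
      have := Finset.mem_Icc.1 (hx1 i)
      exact ⟨x i, Finset.mem_Icc.2 ⟨this.1, le_min hi this.2⟩, hball i⟩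
  have hcard : ∀ p, (P p).card = (ball a N (tentRadius v) α p).card ^ (n + 1) := by
    intro p; rw [hP]; simp only; rw [Fintype.card_piFinset]; simp
  refine h1.trans ?_
  have h3 : s.card ≤ ∑ p ∈ Finset.Icc 1 (min L N), (ball a N (tentRadius v) α p).card ^ (n + 1) +
      ∑ z ∈ Z, (ball a N (tentRadius v) α z.1).card ^ (n + 1) := by
    refine (Finset.card_le_card h2).trans ((Finset.card_union_le _ _).trans ?_)
    refine add_le_add (Finset.card_biUnion_le.trans_eq ?_) (Finset.card_biUnion_le.trans_eq ?_)
    · exact Finset.sum_congr rfl fun p _ => hcard p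
    · exact Finset.sum_congr rfl fun z _ => hcard z.1
  exact_mod_cast h3

/-- The torus average with the single frequency a_{p'} - a_p. Even adjacent indices are allowed,
where no ratio bound is available; this is what the field `diff` provides. -/
lemma Growth.integral_gridTent_sub_le {a : ℕ → ℝ} {L : ℕ} {Q : ℝ} (ha : Growth a L Q) (hQ : 1 ≤ Q)
    {N K : ℝ} (hK : 0 ≤ K) (hN : 4 * (K + 1) ≤ N) {p p' : ℕ} (hp : L < p) (hpp : p < p') (T : ℝ) :
    ∫ α in T..T + 1, gridTent N K 0 (α * (a p' - a p))
      ≤ 2 * (2 * (K + 1) * tentMass / N + (2 + N) / Q) := by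
  have hK1 : 0 < 2 * (K + 1) := by linarith
  have hN0 : 0 < N := by linarith
  set A := N / (2 * (K + 1)) with hA
  have hA2 : 2 ≤ A := by rw [hA, le_div_iff₀ hK1]; linarith
  have hAN : A ≤ N := div_le_self hN0.le (by linarith)
  have key := _root_.abs_integral_sub_cube_le (TorusLipschitz.coord (ι := Unit) (by linarith : 0 ≤ A)
    (0 / N) ()) (by linarith) hQ (A := fun _ => a p' - a p) (fun _ => ha.diff p p' hp hpp)
    (fun i j hij => absurd (Subsingleton.elim i j) hij) T
  have e := integral_cube_prod_pTent (ι := Unit) hA2 (0 / N)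
  simp only [Finset.univ_unique, Finset.prod_singleton, Fintype.card_unit, pow_one,
    PUnit.default_eq_unit] at e
  rw [e] at key
  unfold gridTent
  rw [intervalIntegral.integral_const_mul]
  have e2 : tentMass / A = 2 * (K + 1) * tentMass / N := by rw [hA]; field_simp
  rw [e2, Fintype.card_unit] at key
  have h1 := (abs_le.1 key).2
  have h3 : ((1 : ℕ) : ℝ) * ((2 * 1 + A) / Q) ≤ (2 + N) / Q := by
    rw [Nat.cast_one, one_mul, mul_one]; gcongr
  linarith

/-- First moment of the contribution of tuples that are not separated. -/
theorem exists_integral_crowded_le {n : ℕ} (v : Fin n → ℤ) {M : ℕ} (hM : 1 ≤ M) :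
    ∃ C : ℝ, 0 ≤ C ∧ ∀ (a : ℕ → ℝ) (N L : ℕ) (Q T R : ℝ), 4 * (tentRadius v + 1) ≤ N → 1 ≤ L →
    Growth a L Q → (N : ℝ) ^ (2 * (n + 1) + 2) ≤ Q → 0 < R →
    ∫ α in T..T + 1, ∑ x ∈ crowdedTuples (n + 1) N L, tupleWeight a N M v α x
      ≤ C * (R * L + N * (L : ℝ) ^ (2 * (n + 1) + 2) / R) := by
  obtain ⟨C1, hC1, hmom⟩ := exists_sum_card_ball_pow_le (tentRadius v) (2 * (n + 1))
  have hJ := tentMass_nonneg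
  set K := tentRadius v with hK
  obtain ⟨C2, hC2⟩ : ∃ C2 : ℝ, C2 = 2 * (2 * (K + 1) * tentMass + 3) := ⟨_, rfl⟩
  have hC20 : 0 ≤ C2 := by rw [hC2]; positivity
  refine ⟨1 + C2 + 2 * C1, by positivity, ?_⟩
  intro a N L Q T R hN hL ha hQ hR
  have hN1 : 1 ≤ N := by omega
  have hN1' : (1 : ℝ) ≤ N := by exact_mod_cast hN1
  have hL1' : (1 : ℝ) ≤ L := by exact_mod_cast hL
  have hN0 : (0 : ℝ) < N := by linarith
  have hQ1 : 1 ≤ Q := (one_le_pow₀ hN1').trans hQ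
  obtain ⟨Ψ, hΨc, hΨ, hΨi⟩ := hmom a N L Q T hN hL ha hQ
  set Z := (closePairs N L).filter fun z => L < z.2 ∧ z.2 < z.1 with hZ
  set G := fun α : ℝ => ∑ z ∈ Z, gridTent N K 0 (α * (a z.1 - a z.2)) with hG
  have hGc' : ∀ z : ℕ × ℕ, Continuous fun α : ℝ => gridTent N K 0 (α * (a z.1 - a z.2)) := fun z =>
    (continuous_gridTent _ _ _).comp (by fun_prop)
  have hGc : Continuous G := continuous_finsetSum _ fun z _ => hGc' z
  have hpt : ∀ α, ∑ x ∈ crowdedTuples (n + 1) N L, tupleWeight a N M v α x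
      ≤ R * L / 2 + R / 2 * G α + (1 / 2 + L) / R * Ψ α := by
    intro α
    set m : ℕ → ℝ := fun p => (ball a N K α p).card with hm
    have hm0 : ∀ p, 0 ≤ m p ^ (2 * (n + 1)) := fun p => by positivity
    -- The arithmetic-geometric mean inequality with free parameter R: the constant part is paired
    -- with the number of admissible p or close pairs, the other part with the moment bound.
    have hamgm : ∀ p, m p ^ (n + 1) ≤ R / 2 + m p ^ (2 * (n + 1)) / (2 * R) := by
      intro p
      rw [pow_mul', ← sub_nonneg]
      have : R / 2 + (m p ^ (n + 1)) ^ 2 / (2 * R) - m p ^ (n + 1)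
          = (R - m p ^ (n + 1)) ^ 2 / (2 * R) := by field_simp; ring
      rw [this]; positivity
    refine (sum_crowdedTuples_le a hN1 hM v α).trans ?_
    have h1 : ∑ p ∈ Finset.Icc 1 (min L N), m p ^ (n + 1) ≤ R * L / 2 + Ψ α / (2 * R) := by
      calc _ ≤ ∑ p ∈ Finset.Icc 1 (min L N), (R / 2 + m p ^ (2 * (n + 1)) / (2 * R)) :=
            Finset.sum_le_sum fun p _ => hamgm p
        _ = (min L N : ℕ) * (R / 2) +
            (∑ p ∈ Finset.Icc 1 (min L N), m p ^ (2 * (n + 1))) / (2 * R) := by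
            rw [Finset.sum_add_distrib, Finset.sum_const, nsmul_eq_mul, Nat.card_Icc,
              Nat.add_sub_cancel, ← Finset.sum_div]
        _ ≤ L * (R / 2) + Ψ α / (2 * R) := by
            gcongr
            · exact min_le_left _ _
            · refine le_trans ?_ (hΨ α)
              refine Finset.sum_le_sum_of_subset_of_nonneg ?_ fun p _ _ => hm0 p
              exact Finset.Icc_subset_Icc le_rfl (min_le_right _ _)
        _ = _ := by ring
    have h2 : ∑ z ∈ (closePairs N L).filter (fun z => L < z.2 ∧ z.2 < z.1 ∧
        dInt (α * a z.2 - α * a z.1) ≤ (K : ℝ) / N), m z.1 ^ (n + 1)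
        ≤ R / 2 * G α + L / R * Ψ α := by
      calc _ ≤ ∑ z ∈ (closePairs N L).filter (fun z => L < z.2 ∧ z.2 < z.1 ∧
            dInt (α * a z.2 - α * a z.1) ≤ (K : ℝ) / N),
            (R / 2 * gridTent N K 0 (α * (a z.1 - a z.2)) + m z.1 ^ (2 * (n + 1)) / (2 * R)) := by
            refine Finset.sum_le_sum fun z hz => (hamgm _).trans ?_
            rw [Finset.mem_filter] at hz
            have : 1 ≤ gridTent N K 0 (α * (a z.1 - a z.2)) := by
              refine one_le_gridTent hN0 (Nat.cast_nonneg K) ?_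
              rw [zero_div, sub_zero, mul_sub, dInt_sub_comm]
              refine hz.2.2.2.trans ?_
              gcongr; linarith
            have := mul_le_mul_of_nonneg_left this (show 0 ≤ R / 2 by positivity)
            linarith
        _ = R / 2 * ∑ z ∈ (closePairs N L).filter (fun z => L < z.2 ∧ z.2 < z.1 ∧
            dInt (α * a z.2 - α * a z.1) ≤ (K : ℝ) / N), gridTent N K 0 (α * (a z.1 - a z.2)) +
            (∑ z ∈ (closePairs N L).filter (fun z => L < z.2 ∧ z.2 < z.1 ∧
            dInt (α * a z.2 - α * a z.1) ≤ (K : ℝ) / N), m z.1 ^ (2 * (n + 1))) / (2 * R) := by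
            rw [Finset.sum_add_distrib, ← Finset.mul_sum, ← Finset.sum_div]
        _ ≤ R / 2 * G α + (2 * L * Ψ α) / (2 * R) := by
            gcongr
            · refine Finset.sum_le_sum_of_subset_of_nonneg ?_ fun z _ _ => gridTent_nonneg _ _ _ _
              intro z hz
              rw [Finset.mem_filter] at hz ⊢
              exact ⟨hz.1, hz.2.1, hz.2.2.1⟩
            · refine le_trans (Finset.sum_le_sum_of_subset_of_nonneg (Finset.filter_subset _ _)
                fun z _ _ => hm0 z.1) ?_
              refine (sum_closePairs_fst_le N L hm0).trans ?_
              gcongr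
              exact hΨ α
        _ = _ := by field_simp
    calc _ ≤ _ := add_le_add h1 h2
      _ = _ := by field_simp; ring
  -- At most 2LN close pairs, each close modulo 1 with probability O(1/N).
  have hGint : ∫ α in T..T + 1, G α ≤ 2 * L * C2 := by
    rw [hG, intervalIntegral_sum_of_continuous Z hGc']
    refine (Finset.sum_le_card_nsmul _ _ (C2 / N) fun z hz => ?_).trans ?_
    · rw [hZ, Finset.mem_filter] at hz
      refine (ha.integral_gridTent_sub_le hQ1 (Nat.cast_nonneg K) (by exact_mod_cast hN)
        hz.2.1 hz.2.2 T).trans ?_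
      have h3 : (2 + (N : ℝ)) / Q ≤ 3 / N := by
        rw [div_le_div_iff₀ (by linarith) hN0]
        calc (2 + (N : ℝ)) * N ≤ (2 * N + N) * N := by gcongr; linarith
          _ = 3 * N ^ 2 := by ring
          _ ≤ 3 * N ^ (2 * (n + 1) + 2) := by gcongr <;> first | exact hN1' | omega
          _ ≤ 3 * Q := by gcongr
      calc 2 * (2 * (K + 1) * tentMass / N + (2 + (N : ℝ)) / Q)
          ≤ 2 * (2 * (K + 1) * tentMass / N + 3 / N) := by gcongr
        _ = C2 / N := by rw [hC2]; ring
    · have hc : (Z.card : ℝ) ≤ 2 * L * N := by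
        have h1 : ∑ z ∈ closePairs N L, (1 : ℝ) ≤ 2 * L * ∑ p ∈ Finset.Icc 1 N, (1 : ℝ) :=
          sum_closePairs_fst_le N L (g := fun _ => 1) (fun _ => zero_le_one)
        simp only [Finset.sum_const, nsmul_eq_mul, mul_one, Nat.card_Icc, Nat.add_sub_cancel] at h1
        refine le_trans ?_ h1
        exact_mod_cast Finset.card_filter_le _ _
      rw [nsmul_eq_mul]
      calc (Z.card : ℝ) * (C2 / N) ≤ 2 * L * N * (C2 / N) := by gcongr
        _ = 2 * L * C2 := by field_simp
  have hcL : Continuous fun α => ∑ x ∈ crowdedTuples (n + 1) N L, tupleWeight a N M v α x :=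
    continuous_finsetSum _ fun x _ => continuous_tupleWeight a N M v x
  have hcR : Continuous fun α => R * L / 2 + R / 2 * G α + (1 / 2 + L) / R * Ψ α := by fun_prop
  calc _ ≤ ∫ α in T..T + 1, (R * L / 2 + R / 2 * G α + (1 / 2 + L) / R * Ψ α) :=
        intervalIntegral.integral_mono_on (by linarith) (hcL.intervalIntegrable _ _)
          (hcR.intervalIntegrable _ _) fun α _ => hpt α
    _ = R * L / 2 + R / 2 * (∫ α in T..T + 1, G α)
        + (1 / 2 + L) / R * (∫ α in T..T + 1, Ψ α) := by
        rw [intervalIntegral_add_of_continuous (f := fun α => R * L / 2 + R / 2 * G α)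
          (g := fun α => (1 / 2 + L) / R * Ψ α) (by fun_prop) (by fun_prop),
          intervalIntegral_add_of_continuous (g := fun α => R / 2 * G α) continuous_const
          (by fun_prop), intervalIntegral.integral_const_mul, intervalIntegral.integral_const_mul]
        simp
    _ ≤ R * L / 2 + R / 2 * (2 * L * C2)
        + (1 / 2 + L) / R * (C1 * N * (L : ℝ) ^ (2 * (n + 1) + 1)) := by gcongr
    _ ≤ R * L / 2 + R / 2 * (2 * L * C2)
        + (L + L) / R * (C1 * N * (L : ℝ) ^ (2 * (n + 1) + 1)) := by
        gcongr
        linarith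
    _ = (1 / 2 + C2) * (R * L) + 2 * C1 * (N * (L : ℝ) ^ (2 * (n + 1) + 2) / R) := by
        ring
    _ ≤ (1 + C2 + 2 * C1) * (R * L) + (1 + C2 + 2 * C1) *
        (N * (L : ℝ) ^ (2 * (n + 1) + 2) / R) := by
        refine add_le_add (mul_le_mul_of_nonneg_right (by linarith) (by positivity))
          (mul_le_mul_of_nonneg_right (by linarith) (by positivity))
    _ = _ := by ring

/-! ### Borel–Cantelli and growth of lacunary sequences -/

/-- On each unit interval the sum of the f_j has finite integral, hence is finite almost everywhere,
and its terms tend to 0. Countably many unit intervals cover the line, so the threshold in j may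
depend on T. -/
lemma ae_tendsto_zero_of_integral_le {f : ℕ → ℝ → ℝ} (hf : ∀ j, Continuous (f j))
    (h0 : ∀ j x, 0 ≤ f j x) {b : ℕ → ℝ} (hb : Summable b)
    (h : ∀ T : ℝ, ∀ᶠ j in Filter.atTop, ∫ x in T..T + 1, f j x ≤ b j) :
    ∀ᵐ x : ℝ, Filter.Tendsto (fun j => f j x) Filter.atTop (nhds 0) := by
  have key : ∀ T : ℝ, ∀ᵐ x ∂(volume.restrict (Set.Ioc T (T + 1))),
      Filter.Tendsto (fun j => f j x) Filter.atTop (nhds 0) := by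
    intro T
    have hnn : ∀ j, 0 ≤ ∫ x in T..T + 1, f j x := fun j =>
      intervalIntegral.integral_nonneg (by linarith) fun x _ => h0 j x
    have hs : Summable fun j => ∫ x in T..T + 1, f j x := by
      refine Summable.of_norm_bounded_eventually_nat hb ?_
      filter_upwards [h T] with j hj
      rwa [Real.norm_of_nonneg (hnn j)]
    have e : ∀ j, ∫⁻ x in Set.Ioc T (T + 1), ENNReal.ofReal (f j x)
        = ENNReal.ofReal (∫ x in T..T + 1, f j x) := by
      intro j
      rw [intervalIntegral.integral_of_le (by linarith), ofReal_integral_eq_lintegral_ofReal]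
      · exact (hf j).integrableOn_Ioc
      · exact Filter.Eventually.of_forall fun x => h0 j x
    have hm : ∀ j, Measurable fun x => ENNReal.ofReal (f j x) := fun j =>
      ENNReal.measurable_ofReal.comp (hf j).measurable
    have hfin : ∫⁻ x in Set.Ioc T (T + 1), ∑' j, ENNReal.ofReal (f j x) ≠ ⊤ := by
      rw [lintegral_tsum fun j => (hm j).aemeasurable]
      simp only [e]
      exact hs.tsum_ofReal_ne_top
    filter_upwards [ae_lt_top (Measurable.tsum hm) hfin] with x hx
    have := ENNReal.tendsto_atTop_zero_of_tsum_ne_top hx.ne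
    have h2 := (ENNReal.tendsto_toReal ENNReal.zero_ne_top).comp this
    simpa [Function.comp_def, ENNReal.toReal_ofReal (h0 _ x)] using h2
  have hall : ∀ᵐ x : ℝ, ∀ T : ℤ, x ∈ Set.Ioc (T : ℝ) (T + 1) →
      Filter.Tendsto (fun j => f j x) Filter.atTop (nhds 0) := by
    rw [ae_all_iff]
    intro T
    exact (ae_restrict_iff' measurableSet_Ioc).1 (key T)
  filter_upwards [hall] with x hx
  refine hx (⌈x⌉ - 1) ⟨?_, ?_⟩
  · push_cast; linarith [Int.ceil_lt_add_one x]
  · push_cast; linarith [Int.le_ceil x]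

/-- Each step multiplies by at least c, so every quantity in `Growth` is at least a constant times
c^L, which beats L^m. -/
lemma IsLacunary.eventually_growth {a : ℕ → ℝ} (hlac : IsLacunary a)
    (hpos : ∀ n : ℕ, 1 ≤ n → 0 < a n) (m : ℕ) :
    ∀ᶠ L : ℕ in Filter.atTop, Growth a L ((L : ℝ) ^ m) := by
  obtain ⟨c, hc, hstep⟩ := hlac
  have hc0 : 0 < c := by linarith
  have hmul : ∀ d z : ℕ, 1 ≤ z → c ^ d * a z ≤ a (z + d) := by
    intro d z hz
    induction d with
    | zero => simp
    | succ d ih =>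
      calc c ^ (d + 1) * a z = c * (c ^ d * a z) := by ring
        _ ≤ c * a (z + d) := by gcongr
        _ ≤ a (z + (d + 1)) := hstep (z + d) (by omega)
  have hge : ∀ d z z' : ℕ, 1 ≤ z → z + d ≤ z' → c ^ d * a z ≤ a z' := by
    intro d z z' hz h
    obtain ⟨e, rfl⟩ := Nat.exists_eq_add_of_le h
    have := hmul (d + e) z hz
    rw [← add_assoc] at this
    refine le_trans ?_ this
    have := hpos z hz
    gcongr
    · exact hc.le
    · omega
  have ha1 := hpos 1 le_rfl
  -- The three upper bounds on δ serve `ratio`, `large` and `diff` respectively.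
  obtain ⟨δ, hδ0, hδ1, hδ2, hδ3⟩ : ∃ δ : ℝ, 0 < δ ∧ δ ≤ 1 ∧ δ ≤ a 1 ∧ δ ≤ (c - 1) * a 1 :=
    ⟨min 1 (min (a 1) ((c - 1) * a 1)), by
      have : 0 < (c - 1) * a 1 := mul_pos (by linarith) ha1
      exact lt_min one_pos (lt_min ha1 this), min_le_left _ _,
      (min_le_right _ _).trans (min_le_left _ _), (min_le_right _ _).trans (min_le_right _ _)⟩
  have ht := tendsto_pow_const_div_const_pow_of_one_lt m hc
  filter_upwards [ht.eventually (gt_mem_nhds hδ0)] with L hL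
  have hcL : 0 < c ^ L := by positivity
  have hQ : (L : ℝ) ^ m ≤ δ * c ^ L := by
    rw [div_lt_iff₀ hcL] at hL; exact hL.le
  have hlarge : ∀ z, L < z → c ^ L * a 1 ≤ a z := fun z hz => hge L 1 z le_rfl (by omega)
  refine ⟨fun z hz => ?_, fun z z' hz h => ?_, fun z z' hz h => ?_⟩
  · calc _ ≤ δ * c ^ L := hQ
      _ ≤ a 1 * c ^ L := by gcongr
      _ ≤ a z := by rw [mul_comm]; exact hlarge z hz
  · have := hpos z (by omega)
    calc _ ≤ (δ * c ^ L) * a z := by gcongr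
      _ ≤ (1 * c ^ L) * a z := by gcongr
      _ ≤ a z' := by rw [one_mul]; exact hge L z z' (by omega) h
  · have h1 := hge 1 z z' (by omega) h
    have h2 := mul_le_mul_of_nonneg_left (hlarge z hz) (show 0 ≤ c - 1 by linarith)
    have h3 : δ * c ^ L ≤ (c - 1) * a 1 * c ^ L := by gcongr
    rw [pow_one] at h1
    linarith

/-! ### Almost sure convergence along the sparse subsequence -/

/-- The exponent of the sparse subsequence `L ^ sparseExp n`. -/
def sparseExp (n : ℕ) : ℕ := 2 * (2 * (n + 1) + 4)

/-- For L ≥ 1 separated tuples are automatically injective. -/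
lemma sum_distinctTuples_split {n N L : ℕ} (hL : 1 ≤ L) (g : (Fin (n + 1) → ℕ) → ℝ) :
    ∑ x ∈ distinctTuples (n + 1) N, g x
      = ∑ x ∈ separatedTuples (n + 1) N L, g x + ∑ x ∈ crowdedTuples (n + 1) N L, g x := by
  classical
  rw [crowdedTuples, ← Finset.sum_filter_add_sum_filter_not (distinctTuples (n + 1) N)
    (fun x => Separated L x)]
  congr 1
  refine Finset.sum_congr ?_ fun _ _ => rfl
  ext x
  simp only [separatedTuples, distinctTuples, Finset.mem_filter, and_assoc]
  refine and_congr_right fun _ => ⟨fun h => h.2, fun h => ⟨fun i j hij => ?_, h⟩⟩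
  by_contra hne
  have := h.2 i j hne
  omega

/-- The non-separated proportion is O(L/N), and D ≥ 2 makes this O(1/L). -/
lemma tendsto_card_separatedTuples_div (n : ℕ) {D : ℕ} (hD : 2 ≤ D) :
    Filter.Tendsto (fun L : ℕ => ((separatedTuples (n + 1) (L ^ D) L).card : ℝ) /
      ((L ^ D : ℕ) : ℝ) ^ (n + 1)) Filter.atTop (nhds 1) := by
  classical
  have hlow : ∀ᶠ L : ℕ in Filter.atTop, 1 - 3 * ((n : ℝ) + 1) ^ 2 * (1 / (L : ℝ))
      ≤ ((separatedTuples (n + 1) (L ^ D) L).card : ℝ) / ((L ^ D : ℕ) : ℝ) ^ (n + 1) := by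
    filter_upwards [Filter.eventually_ge_atTop 1] with L hL
    have hL' : (1 : ℝ) ≤ L := by exact_mod_cast hL
    have hN : (0 : ℝ) < ((L ^ D : ℕ) : ℝ) := by positivity
    have hLN : (L : ℝ) * L ≤ ((L ^ D : ℕ) : ℝ) := by
      push_cast; rw [← sq]; exact pow_le_pow_right₀ hL' hD
    set N := L ^ D
    have h1 : ((separatedTuples (n + 1) N L).card : ℝ) +
        (((Fintype.piFinset fun _ : Fin (n + 1) => Finset.Icc 1 N).filter
          fun z => ¬Separated L z).card : ℝ) = (N : ℝ) ^ (n + 1) := by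
      have := Finset.card_filter_add_card_filter_not (s := Fintype.piFinset
        fun _ : Fin (n + 1) => Finset.Icc 1 N) (fun z => Separated L z)
      rw [Fintype.card_piFinset] at this
      simp only [Nat.card_Icc, Nat.add_sub_cancel, Finset.prod_const, Finset.card_univ,
        Fintype.card_fin] at this
      unfold separatedTuples
      exact_mod_cast this
    have h2 : (((Fintype.piFinset fun _ : Fin (n + 1) => Finset.Icc 1 N).filter
          fun z => ¬Separated L z).card : ℝ) * N ≤ 3 * ((n : ℝ) + 1) ^ 2 * L * N ^ (n + 1) := by
      have := card_not_separated_le (ι := Fin (n + 1)) N L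
      rw [Fintype.card_fin] at this
      exact_mod_cast this
    set B := (((Fintype.piFinset fun _ : Fin (n + 1) => Finset.Icc 1 N).filter
          fun z => ¬Separated L z).card : ℝ)
    have h3 : B ≤ 3 * ((n : ℝ) + 1) ^ 2 * (1 / L) * N ^ (n + 1) := by
      refine le_of_mul_le_mul_right (h2.trans ?_) hN
      have : (L : ℝ) ≤ 1 / L * N := by
        rw [one_div, inv_mul_eq_div, le_div_iff₀ (by linarith)]; exact hLN
      calc _ ≤ 3 * ((n : ℝ) + 1) ^ 2 * (1 / L * N) * N ^ (n + 1) := by gcongr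
        _ = _ := by ring
    rw [le_div_iff₀ (by positivity)]
    linarith
  have hup : ∀ᶠ L : ℕ in Filter.atTop, ((separatedTuples (n + 1) (L ^ D) L).card : ℝ) /
      ((L ^ D : ℕ) : ℝ) ^ (n + 1) ≤ 1 := by
    filter_upwards with L
    refine div_le_one_of_le₀ ?_ (by positivity)
    exact_mod_cast card_separatedTuples_le (n + 1) (L ^ D) L
  have hlim : Filter.Tendsto (fun L : ℕ => 1 - 3 * ((n : ℝ) + 1) ^ 2 * (1 / (L : ℝ))) Filter.atTop
      (nhds 1) := by
    have := (tendsto_one_div_atTop_nhds_zero_nat (𝕜 := ℝ)).const_mul (3 * ((n : ℝ) + 1) ^ 2)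
    simpa using this.const_sub 1
  exact tendsto_of_tendsto_of_tendsto_of_le_of_le' hlim tendsto_const_nhds hlow hup

/-- Almost sure convergence along the sparse subsequence for products of hat functions. -/
theorem ae_tendsto_sparse_tupleWeight {a : ℕ → ℝ} (hlac : IsLacunary a)
    (hpos : ∀ n : ℕ, 1 ≤ n → 0 < a n) {n : ℕ} (v : Fin n → ℤ) {M : ℕ} (hM : 1 ≤ M) :
    ∀ᵐ α : ℝ, Filter.Tendsto (fun L : ℕ => 1 / ((L ^ sparseExp n : ℕ) : ℝ) *
      ∑ x ∈ distinctTuples (n + 1) (L ^ sparseExp n), tupleWeight a (L ^ sparseExp n) M v α x)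
      Filter.atTop (nhds ((tentMass / M) ^ n)) := by
  obtain ⟨C1, hC1, hvar⟩ := exists_integral_sq_separated_le v hM
  obtain ⟨C2, hC2, hcr⟩ := exists_integral_crowded_le v hM
  have hM0 : (M : ℝ) ≠ 0 := by positivity
  obtain ⟨p, hp⟩ : ∃ p, p = 2 * (n + 1) + 2 := ⟨_, rfl⟩
  obtain ⟨D, hDdef⟩ : ∃ D, D = sparseExp n := ⟨_, rfl⟩
  -- With N = L^D the normalized second moment is at most C1·L^p/N = C1·L^(-(p+4)). The even
  -- exponent makes √N = L^(p+2) available for the crowded tuples.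
  have hD : D = (p + 2) + (p + 2) := by rw [hDdef, sparseExp, hp]; ring
  rw [← hDdef]
  rw [← hp] at hvar hcr
  have hconds : ∀ᶠ L : ℕ in Filter.atTop, 1 ≤ L ∧ 4 * (tentRadius v + 1) ≤ L ^ D ∧
      Growth a L ((L : ℝ) ^ (D * p)) := by
    filter_upwards [hlac.eventually_growth hpos (D * p), Filter.eventually_ge_atTop 1,
      Filter.eventually_ge_atTop (4 * (tentRadius v + 1))] with L h1 h2 h3
    exact ⟨h2, h3.trans (Nat.le_self_pow (by omega) L), h1⟩
  have hQ : ∀ L : ℕ, ((L ^ D : ℕ) : ℝ) ^ p ≤ (L : ℝ) ^ (D * p) := fun L => by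
    rw [pow_mul]; push_cast; exact le_rfl
  set V := fun (L : ℕ) (α : ℝ) => 1 / ((L ^ D : ℕ) : ℝ) *
    ∑ x ∈ separatedTuples (n + 1) (L ^ D) L,
      (tupleWeight a (L ^ D) M v α x - (tentMass / (((L ^ D : ℕ) : ℝ) * M)) ^ n) with hV
  set W := fun (L : ℕ) (α : ℝ) => 1 / ((L ^ D : ℕ) : ℝ) *
    ∑ x ∈ crowdedTuples (n + 1) (L ^ D) L, tupleWeight a (L ^ D) M v α x with hW
  have hVae : ∀ᵐ α : ℝ, Filter.Tendsto (fun L => V L α ^ 2) Filter.atTop (nhds 0) := by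
    refine ae_tendsto_zero_of_integral_le (b := fun L => C1 * (1 / (L : ℝ) ^ 2)) ?_
      (fun L α => sq_nonneg _) ((Real.summable_one_div_nat_pow.2 one_lt_two).mul_left C1) ?_
    · intro L
      exact (continuous_const.mul (continuous_finsetSum _ fun x _ =>
        (continuous_tupleWeight _ _ _ _ _).sub continuous_const)).pow 2
    · intro T
      filter_upwards [hconds] with L hL
      have hL0 : (1 : ℝ) ≤ L := by exact_mod_cast hL.1
      simp only [hV, mul_pow]
      rw [intervalIntegral.integral_const_mul]
      have h1 := hvar a (L ^ D) L _ T hL.2.1 hL.1 hL.2.2 (hQ L)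
      refine (mul_le_mul_of_nonneg_left h1 (by positivity)).trans ?_
      have e : (1 / ((L ^ D : ℕ) : ℝ)) ^ 2 * (C1 * ((L ^ D : ℕ) : ℝ) * L ^ p)
          = C1 * (1 / (L : ℝ) ^ (p + 4)) := by
        rw [hD]; push_cast
        field_simp
        ring
      rw [e]
      gcongr
      omega
  have hWae : ∀ᵐ α : ℝ, Filter.Tendsto (fun L => W L α) Filter.atTop (nhds 0) := by
    refine ae_tendsto_zero_of_integral_le (b := fun L => 2 * C2 * (1 / (L : ℝ) ^ 2)) ?_
      (fun L α => ?_) ((Real.summable_one_div_nat_pow.2 one_lt_two).mul_left (2 * C2)) ?_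
    · intro L
      exact continuous_const.mul (continuous_finsetSum _ fun x _ =>
        continuous_tupleWeight _ _ _ _ _)
    · exact mul_nonneg (by positivity) (Finset.sum_nonneg fun x _ => tupleWeight_nonneg _ _ _ _ _ _)
    · intro T
      filter_upwards [hconds] with L hL
      have hL0 : (1 : ℝ) ≤ L := by exact_mod_cast hL.1
      simp only [hW]
      rw [intervalIntegral.integral_const_mul]
      -- Taking R = √N = L^(p+2), the two terms divided by N become L^(-(p+1)) and L^(-2), both
      -- summable.
      have h1 := hcr a (L ^ D) L _ T ((L : ℝ) ^ (p + 2)) hL.2.1 hL.1 hL.2.2 (hQ L) (by positivity)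
      refine (mul_le_mul_of_nonneg_left h1 (by positivity)).trans ?_
      have e : 1 / ((L ^ D : ℕ) : ℝ) *
          (C2 * ((L : ℝ) ^ (p + 2) * L + ((L ^ D : ℕ) : ℝ) * L ^ p / L ^ (p + 2)))
          = C2 * (1 / (L : ℝ) ^ (p + 1) + 1 / (L : ℝ) ^ 2) := by
        rw [hD]; push_cast
        field_simp
        ring
      rw [e, mul_comm 2, mul_assoc, two_mul]
      gcongr
      omega
  filter_upwards [hVae, hWae] with α h1 h2
  have h1' : Filter.Tendsto (fun L => V L α) Filter.atTop (nhds 0) := by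
    have := h1.sqrt
    simp only [Real.sqrt_sq_eq_abs, Real.sqrt_zero] at this
    exact (tendsto_zero_iff_abs_tendsto_zero _).2 this
  -- The mean subtracted in `V` is restored: the number of separated tuples times `(tentMass / (N *
  -- M)) ^ n`, over N, is their proportion times `(tentMass / M) ^ n`.
  have h3 := (tendsto_card_separatedTuples_div n (D := D) (by omega)).mul_const
    ((tentMass / (M : ℝ)) ^ n)
  have h4 := (h1'.add h3).add h2
  rw [zero_add, one_mul, add_zero] at h4
  refine h4.congr' ?_
  filter_upwards [Filter.eventually_ge_atTop 1] with L hL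
  have hN : ((L ^ D : ℕ) : ℝ) ≠ 0 := by positivity
  rw [sum_distinctTuples_split hL]
  simp only [hV, hW]
  rw [Finset.sum_sub_distrib, Finset.sum_const, nsmul_eq_mul]
  generalize ((L ^ D : ℕ) : ℝ) = N at hN ⊢
  rw [mul_add, mul_sub, div_pow, div_pow, mul_pow]
  field_simp
  ring

/-! ### Correlation sums as positive linear functionals of the test function -/

/-- The sum of `f (s (Δ(x) - m))` over distinct tuples `x` up to `N` and integer vectors `m`. -/
noncomputable def corrMass {n : ℕ} (b : ℕ → ℝ) (N : ℕ) (s : ℝ) (f : (Fin n → ℝ) → ℝ) : ℝ :=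
  ∑ x ∈ distinctTuples (n + 1) N, ∑' m : Fin n → ℤ,
    f (fun i => s * (consecutiveDiff (k := n + 1) b x i - m i))

lemma HasCompactSupport.exists_box {n : ℕ} {f : (Fin n → ℝ) → ℝ} (hf : HasCompactSupport f) :
    ∃ R : ℕ, 1 ≤ R ∧ ∀ y, f y ≠ 0 → ∀ i, |y i| ≤ R := by
  obtain ⟨r, hr⟩ := hf.isCompact.isBounded.exists_norm_le
  refine ⟨⌈r⌉₊ + 1, by omega, fun y hy i => ?_⟩
  have h1 := hr y (subset_tsupport f hy)
  have h2 := norm_le_pi_norm y i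
  have h3 := Nat.le_ceil r
  rw [Real.norm_eq_abs] at h2
  push_cast
  linarith

lemma finite_support_shift {n : ℕ} {f : (Fin n → ℝ) → ℝ} (hf : HasCompactSupport f) {s : ℝ}
    (hs : 0 < s) (y : Fin n → ℝ) :
    (Function.support fun m : Fin n → ℤ => f (fun i => s * (y i - m i))).Finite := by
  obtain ⟨R, -, hR⟩ := hf.exists_box
  refine (Set.Finite.pi' fun i : Fin n =>
    Set.finite_Icc ⌈y i - R / s⌉ ⌊y i + R / s⌋).subset fun m hm i => ?_
  have h := hR _ hm i
  simp only [abs_mul, abs_of_pos hs] at h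
  rw [← le_div_iff₀' hs, abs_le] at h
  rw [Set.mem_Icc, Int.ceil_le, Int.le_floor]
  constructor <;> linarith

section corrMass

variable {n : ℕ} {b : ℕ → ℝ} {N : ℕ} {s : ℝ} {f g : (Fin n → ℝ) → ℝ}

lemma summable_shift (hf : HasCompactSupport f) (hs : 0 < s) (y : Fin n → ℝ) :
    Summable fun m : Fin n → ℤ => f (fun i => s * (y i - m i)) :=
  summable_of_hasFiniteSupport (finite_support_shift hf hs y)

lemma correlationSum_eq (hf : HasCompactSupport f) (hN : 1 ≤ N) :
    correlationSum (n + 1) f b N = 1 / (N : ℝ) * corrMass b N N f := by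
  have hN' : (0 : ℝ) < N := by exact_mod_cast hN
  unfold correlationSum corrMass
  congr 1
  exact Summable.tsum_finsetSum fun x _ => summable_shift hf hN' _

lemma corrMass_add (hf : HasCompactSupport f) (hg : HasCompactSupport g) (hs : 0 < s) :
    corrMass b N s (fun y => f y + g y) = corrMass b N s f + corrMass b N s g := by
  unfold corrMass
  rw [← Finset.sum_add_distrib]
  exact Finset.sum_congr rfl fun x _ =>
    (summable_shift hf hs _).tsum_add (summable_shift hg hs _)

lemma corrMass_const_mul (c : ℝ) :
    corrMass b N s (fun y => c * f y) = c * corrMass b N s f := by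
  unfold corrMass
  rw [Finset.mul_sum]
  exact Finset.sum_congr rfl fun x _ => tsum_mul_left

lemma hasCompactSupport_sum {σ : Type*} (S : Finset σ) {F : σ → (Fin n → ℝ) → ℝ}
    (hF : ∀ v, HasCompactSupport (F v)) : HasCompactSupport fun y => ∑ v ∈ S, F v y := by
  classical
  induction S using Finset.induction_on with
  | empty => exact HasCompactSupport.zero
  | insert v S hv ih =>
    simp only [Finset.sum_insert hv]
    exact (hF v).add ih

lemma corrMass_sum {σ : Type*} (S : Finset σ) {F : σ → (Fin n → ℝ) → ℝ}
    (hF : ∀ v, HasCompactSupport (F v)) (hs : 0 < s) :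
    corrMass b N s (fun y => ∑ v ∈ S, F v y) = ∑ v ∈ S, corrMass b N s (F v) := by
  classical
  induction S using Finset.induction_on with
  | empty => simp [corrMass]
  | insert v S hv ih =>
    simp only [Finset.sum_insert hv]
    rw [corrMass_add (hF v) (hasCompactSupport_sum S hF) hs, ih]

lemma corrMass_mono (hf : HasCompactSupport f) (hg : HasCompactSupport g) (hs : 0 < s)
    (h : ∀ y, f y ≤ g y) : corrMass b N s f ≤ corrMass b N s g :=
  Finset.sum_le_sum fun _ _ =>
    (summable_shift hf hs _).tsum_le_tsum (fun _ => h _) (summable_shift hg hs _)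

lemma distinctTuples_mono (k : ℕ) {N N' : ℕ} (h : N ≤ N') :
    distinctTuples k N ⊆ distinctTuples k N' :=
  Finset.filter_subset_filter _ (Fintype.piFinset_subset _ _ fun _ =>
    Finset.Icc_subset_Icc le_rfl h)

lemma corrMass_mono_count {N' : ℕ} (h : N ≤ N') (hf : ∀ y, 0 ≤ f y) :
    corrMass b N s f ≤ corrMass b N' s f :=
  Finset.sum_le_sum_of_subset_of_nonneg (distinctTuples_mono _ h)
    fun _ _ _ => tsum_nonneg fun _ => hf _

/-- Changing the scale at fixed count is a dilation of the test function; this is the reason for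
keeping s independent of N. -/
lemma corrMass_rescale {t : ℝ} (ht : t ≠ 0) :
    corrMass b N s f = corrMass b N t (fun y => f (fun i => s / t * y i)) := by
  unfold corrMass
  refine Finset.sum_congr rfl fun x _ => tsum_congr fun m => ?_
  congr 1
  funext i
  field_simp

end corrMass

/-! ### Approximation of test functions by hats -/

lemma corrMass_tentProd {n : ℕ} {a : ℕ → ℝ} {α : ℝ} {N M : ℕ} (hN : 2 ≤ N) (hM : 1 ≤ M)
    (v : Fin n → ℤ) :
    corrMass (fun j => α * a j) N N (tentProd (M : ℝ) v)
      = ∑ x ∈ distinctTuples (n + 1) N, tupleWeight a N M v α x := by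
  have hN' : (2 : ℝ) ≤ N := by exact_mod_cast hN
  have hM' : (1 : ℝ) ≤ M := by exact_mod_cast hM
  refine Finset.sum_congr rfl fun x _ => ?_
  rw [tsum_tentProd (by linarith) (by linarith) (by nlinarith)]
  rfl

lemma continuous_tentProd {n : ℕ} (M : ℝ) (v : Fin n → ℤ) : Continuous (tentProd M v) :=
  continuous_finsetProd _ fun i _ => continuous_tent.comp (by fun_prop)

lemma abs_sub_lt_of_tentProd_ne_zero {n : ℕ} {M : ℝ} {v : Fin n → ℤ} {y : Fin n → ℝ}
    (h : tentProd M v y ≠ 0) (i : Fin n) : |M * y i - v i| < 1 := by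
  by_contra hc
  exact h (Finset.prod_eq_zero (Finset.mem_univ i) (tent_eq_zero (not_lt.1 hc)))

lemma tentProd_nonneg {n : ℕ} (M : ℝ) (v : Fin n → ℤ) (y : Fin n → ℝ) : 0 ≤ tentProd M v y :=
  Finset.prod_nonneg fun _ _ => tent_nonneg _

lemma hasCompactSupport_tentProd {n : ℕ} {M : ℝ} (hM : 1 ≤ M) (v : Fin n → ℤ) :
    HasCompactSupport (tentProd M v) := by
  refine HasCompactSupport.of_support_subset_isCompact
    (isCompact_univ_pi fun i : Fin n => isCompact_Icc (a := (v i - 1) / M) (b := (v i + 1) / M))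
    fun y hy i _ => ?_
  have h := abs_lt.1 (abs_sub_lt_of_tentProd_ne_zero hy i)
  rw [Set.mem_Icc, div_le_iff₀ (by linarith), le_div_iff₀ (by linarith)]
  constructor <;> linarith

/-- Only the hats at ⌊t⌋ and ⌊t⌋ + 1 can be nonzero at t, and they add up to 1; hence the range
reaches one past B. -/
lemma sum_tent_eq_one {B : ℕ} {t : ℝ} (ht : |t| ≤ B) :
    ∑ v ∈ Finset.Icc (-(B + 1 : ℤ)) (B + 1), tent (t - v) = 1 := by
  rw [abs_le] at ht
  have h1 := Int.floor_le t
  have h2 := Int.lt_floor_add_one t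
  have hl : -(B : ℤ) ≤ ⌊t⌋ := by rw [Int.le_floor]; push_cast; linarith
  have hu : ⌊t⌋ ≤ (B : ℤ) := by
    have : ⌊t⌋ ≤ ⌊(B : ℝ)⌋ := Int.floor_le_floor ht.2
    simpa using this
  have hsub : ({⌊t⌋, ⌊t⌋ + 1} : Finset ℤ) ⊆ Finset.Icc (-(B + 1 : ℤ)) (B + 1) := by
    intro v hv
    rw [Finset.mem_insert, Finset.mem_singleton] at hv
    rw [Finset.mem_Icc]
    omega
  rw [← Finset.sum_subset hsub, Finset.sum_pair (by omega)]
  · unfold tent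
    push_cast
    rw [abs_of_nonneg (by linarith), abs_of_nonpos (by linarith), max_eq_right (by linarith),
      max_eq_right (by linarith)]
    ring
  · intro v _ hv
    rw [Finset.mem_insert, Finset.mem_singleton, not_or] at hv
    refine tent_eq_zero ?_
    rcases lt_or_gt_of_ne hv.1 with h | h
    · have : (v : ℝ) + 1 ≤ ⌊t⌋ := by exact_mod_cast h
      rw [abs_of_nonneg (by linarith)]; linarith
    · have h' : ⌊t⌋ + 2 ≤ v := by omega
      have : (⌊t⌋ : ℝ) + 2 ≤ v := by exact_mod_cast h'
      rw [abs_of_nonpos (by linarith)]; linarith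

/-- The integer vectors with entries of absolute value at most `B`. -/
noncomputable def intBox (n B : ℕ) : Finset (Fin n → ℤ) :=
  Fintype.piFinset fun _ => Finset.Icc (-(B : ℤ)) B

lemma sum_tentProd_eq_one {n B : ℕ} {M : ℝ} {y : Fin n → ℝ} (hy : ∀ i, |M * y i| ≤ B) :
    ∑ v ∈ intBox n (B + 1), tentProd M v y = 1 := by
  unfold intBox tentProd
  rw [← Finset.prod_univ_sum (fun _ : Fin n => Finset.Icc (-((B + 1 : ℕ) : ℤ)) ((B + 1 : ℕ) : ℤ))
    (fun i v => tent (M * y i - v))]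
  refine Finset.prod_eq_one fun i _ => ?_
  have := sum_tent_eq_one (hy i)
  exact_mod_cast this

/-- A continuous cutoff function equal to `1` on the box of radius `R`. -/
noncomputable def boxCutoff (n R : ℕ) (y : Fin n → ℝ) : ℝ :=
  ∑ v ∈ intBox n (R + 1), tentProd (1 : ℕ) v y

lemma boxCutoff_nonneg (n R : ℕ) (y : Fin n → ℝ) : 0 ≤ boxCutoff n R y :=
  Finset.sum_nonneg fun _ _ => tentProd_nonneg _ _ _

lemma boxCutoff_eq_one {n R : ℕ} {y : Fin n → ℝ} (hy : ∀ i, |y i| ≤ R) : boxCutoff n R y = 1 :=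
  sum_tentProd_eq_one fun i => by simpa using hy i

lemma hasCompactSupport_boxCutoff (n R : ℕ) : HasCompactSupport (boxCutoff n R) :=
  hasCompactSupport_sum _ fun v => hasCompactSupport_tentProd (by simp) v

lemma continuous_boxCutoff (n R : ℕ) : Continuous (boxCutoff n R) :=
  continuous_finsetSum _ fun v _ => continuous_tentProd _ v

/-- Uniform continuity and the hat partition of unity of mesh 1/M. Hats centred in the box of f
reach at most 1/M ≤ 1 beyond it, so R does not depend on ε, and the error has a fixed cutoff as
majorant, whose correlation sums and integral are controlled. -/
lemma exists_tentProd_approx {n : ℕ} {f : (Fin n → ℝ) → ℝ} (hc : Continuous f)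
    (hf : HasCompactSupport f) : ∃ R : ℕ, ∀ ε > 0, ∃ M : ℕ, 1 ≤ M ∧ ∃ B : ℕ, ∀ y,
      |f y - ∑ v ∈ intBox n B, f (fun i => v i / M) * tentProd M v y| ≤ ε * boxCutoff n R y := by
  obtain ⟨R, hR1, hR⟩ := hf.exists_box
  refine ⟨R + 1, fun ε hε => ?_⟩
  obtain ⟨δ, hδ, hu⟩ := Metric.uniformContinuous_iff.1 (hf.uniformContinuous_of_continuous hc) ε hε
  obtain ⟨M, hM⟩ := exists_nat_gt (1 / δ)
  have hM0 : (0 : ℝ) < M := (by positivity : 0 < 1 / δ).trans hM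
  have hM1 : 1 ≤ M := by exact_mod_cast hM0
  have hM1' : (1 : ℝ) ≤ M := by exact_mod_cast hM1
  refine ⟨M, hM1, M * (R + 1) + 1, fun y => ?_⟩
  by_cases hy : ∀ i, |y i| ≤ ((R + 1 : ℕ) : ℝ)
  · rw [boxCutoff_eq_one hy, mul_one]
    have h1 : ∑ v ∈ intBox n (M * (R + 1) + 1), tentProd M v y = 1 := by
      refine sum_tentProd_eq_one fun i => ?_
      rw [abs_mul, abs_of_pos hM0, Nat.cast_mul]
      gcongr
      exact hy i
    calc |f y - ∑ v ∈ intBox n (M * (R + 1) + 1), f (fun i => v i / M) * tentProd M v y|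
        = |∑ v ∈ intBox n (M * (R + 1) + 1), (f y - f (fun i => v i / M)) * tentProd M v y| := by
          congr 1
          simp only [sub_mul]
          rw [Finset.sum_sub_distrib, ← Finset.mul_sum, h1, mul_one]
      _ ≤ ∑ v ∈ intBox n (M * (R + 1) + 1), ε * tentProd M v y := by
          refine (Finset.abs_sum_le_sum_abs _ _).trans (Finset.sum_le_sum fun v _ => ?_)
          rw [abs_mul, abs_of_nonneg (tentProd_nonneg _ _ _)]
          by_cases h0 : tentProd (M : ℝ) v y = 0
          · simp [h0]
          refine mul_le_mul_of_nonneg_right ?_ (tentProd_nonneg _ _ _)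
          rw [← Real.dist_eq]
          refine (hu ?_).le
          rw [dist_pi_lt_iff hδ]
          intro i
          have h2 := abs_sub_lt_of_tentProd_ne_zero h0 i
          have h3 : y i - v i / M = (M * y i - v i) / M := by field_simp
          rw [Real.dist_eq, h3, abs_div, abs_of_pos hM0]
          calc _ < 1 / (M : ℝ) := by gcongr
            _ < δ := by rw [div_lt_comm₀ hM0 hδ]; exact hM
      _ = ε := by rw [← Finset.mul_sum, h1, mul_one]
  · push Not at hy
    obtain ⟨i, hi⟩ := hy
    have hfy : f y = 0 := by
      by_contra h
      have := hR y h i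
      push_cast at hi
      linarith
    have hs : ∑ v ∈ intBox n (M * (R + 1) + 1), f (fun i => v i / M) * tentProd M v y = 0 := by
      refine Finset.sum_eq_zero fun v _ => ?_
      by_contra h
      have h1 := hR _ (left_ne_zero_of_mul h) i
      have h2 := abs_sub_lt_of_tentProd_ne_zero (right_ne_zero_of_mul h) i
      have h3 : y i - v i / M = (M * y i - v i) / M := by field_simp
      have h4 : |y i - v i / M| ≤ 1 := by
        rw [h3, abs_div, abs_of_pos hM0, div_le_one hM0]; linarith
      have h5 := abs_sub_abs_le_abs_sub (y i) (v i / M)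
      push_cast at hi
      linarith
    rw [hfy, hs, sub_zero, abs_zero]
    exact mul_nonneg hε.le (boxCutoff_nonneg _ _ _)

/-- For r > 1/2 the dilate is supported in the box of twice the radius, where uniform continuity
applies; outside that box both functions vanish. -/
lemma exists_scaling_approx {n : ℕ} {f : (Fin n → ℝ) → ℝ} (hc : Continuous f)
    (hf : HasCompactSupport f) : ∃ R : ℕ, ∀ ε > 0, ∃ δ > 0, ∀ r : ℝ, |r - 1| < δ → ∀ y,
      |f (fun i => r * y i) - f y| ≤ ε * boxCutoff n R y := by
  obtain ⟨R, hR1, hR⟩ := hf.exists_box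
  have hR1' : (1 : ℝ) ≤ R := by exact_mod_cast hR1
  refine ⟨2 * R, fun ε hε => ?_⟩
  obtain ⟨δ, hδ, hu⟩ := Metric.uniformContinuous_iff.1 (hf.uniformContinuous_of_continuous hc) ε hε
  refine ⟨min (1 / 2) (δ / (2 * R)), by positivity, fun r hr y => ?_⟩
  have hr1 := hr.trans_le (min_le_left _ _)
  have hr2 := hr.trans_le (min_le_right _ _)
  by_cases hy : ∀ i, |y i| ≤ ((2 * R : ℕ) : ℝ)
  · rw [boxCutoff_eq_one hy, mul_one, ← Real.dist_eq]
    refine (hu ?_).le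
    rw [dist_pi_lt_iff hδ]
    intro i
    have h1 := hy i
    rw [Real.dist_eq, show r * y i - y i = (r - 1) * y i by ring, abs_mul]
    rw [lt_div_iff₀ (by positivity)] at hr2
    refine lt_of_le_of_lt ?_ hr2
    push_cast at h1
    gcongr
  · push Not at hy
    obtain ⟨i, hi⟩ := hy
    push_cast at hi
    have h1 : f y = 0 := by
      by_contra h
      have := hR y h i
      linarith
    have h2 : f (fun i => r * y i) = 0 := by
      by_contra h
      have := hR _ h i
      simp only [abs_mul] at this
      have h3 : 1 / 2 ≤ |r| := by
        have := abs_lt.1 hr1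
        exact le_trans (by linarith) (le_abs_self r)
      have := mul_le_mul_of_nonneg_right h3 (abs_nonneg (y i))
      linarith
    rw [h1, h2, sub_zero, abs_zero]
    exact mul_nonneg hε.le (boxCutoff_nonneg _ _ _)

lemma integral_sub_le_of_abs_sub_le {n : ℕ} {f g h : (Fin n → ℝ) → ℝ} (hf : Integrable f)
    (hg : Integrable g) (hh : Integrable h) (H : ∀ y, |f y - g y| ≤ h y) :
    |(∫ y, f y) - ∫ y, g y| ≤ ∫ y, h y := by
  rw [← integral_sub hf hg]
  exact (abs_integral_le_integral_abs).trans (integral_mono (hf.sub hg).abs hh H)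

lemma abs_corrMass_sub_le {n : ℕ} {b : ℕ → ℝ} {N : ℕ} {s : ℝ} {f g h : (Fin n → ℝ) → ℝ}
    (hf : HasCompactSupport f) (hg : HasCompactSupport g) (hh : HasCompactSupport h) (hs : 0 < s)
    (H : ∀ y, |f y - g y| ≤ h y) :
    |corrMass b N s f - corrMass b N s g| ≤ corrMass b N s h := by
  have h1 : corrMass b N s f ≤ corrMass b N s (fun y => g y + h y) :=
    corrMass_mono hf (hg.add hh) hs fun y => by linarith [(abs_le.1 (H y)).2]
  have h2 : corrMass b N s g ≤ corrMass b N s (fun y => f y + h y) :=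
    corrMass_mono hg (hf.add hh) hs fun y => by linarith [(abs_le.1 (H y)).1]
  rw [corrMass_add hg hh hs] at h1
  rw [corrMass_add hf hh hs] at h2
  rw [abs_le]; constructor <;> linarith

/-- Convergence for products of hat functions implies convergence for all continuous compactly
supported functions. -/
theorem tendsto_corrMass_of_tentProd {n : ℕ} {b : ℕ → ℝ} {ν : ℕ → ℕ}
    (hν : ∀ᶠ j in Filter.atTop, 1 ≤ ν j)
    (H : ∀ M : ℕ, 1 ≤ M → ∀ v : Fin n → ℤ, Filter.Tendsto
      (fun j => 1 / (ν j : ℝ) * corrMass b (ν j) (ν j) (tentProd (M : ℝ) v)) Filter.atTop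
      (nhds (∫ y, tentProd (M : ℝ) v y)))
    {f : (Fin n → ℝ) → ℝ} (hc : Continuous f) (hf : HasCompactSupport f) :
    Filter.Tendsto (fun j => 1 / (ν j : ℝ) * corrMass b (ν j) (ν j) f) Filter.atTop
      (nhds (∫ y, f y)) := by
  have hsum : ∀ (M : ℕ) (_ : 1 ≤ M) (S : Finset (Fin n → ℤ)) (u : (Fin n → ℤ) → ℝ),
      Filter.Tendsto (fun j => 1 / (ν j : ℝ) * corrMass b (ν j) (ν j)
        (fun y => ∑ v ∈ S, u v * tentProd (M : ℝ) v y)) Filter.atTop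
      (nhds (∫ y, ∑ v ∈ S, u v * tentProd (M : ℝ) v y)) := by
    intro M hM S u
    have hM' : (1 : ℝ) ≤ M := by exact_mod_cast hM
    have e : ∫ y, ∑ v ∈ S, u v * tentProd (M : ℝ) v y = ∑ v ∈ S, u v * ∫ y, tentProd (M : ℝ) v y := by
      rw [integral_finsetSum _ fun v _ => ((continuous_tentProd (M : ℝ) v).integrable_of_hasCompactSupport
        (hasCompactSupport_tentProd hM' v)).const_mul _]
      simp only [integral_const_mul]
    rw [e]
    have := tendsto_finsetSum S fun v _ => (H M hM v).const_mul (u v)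
    refine this.congr' ?_
    filter_upwards [hν] with j hj
    have hj' : (0 : ℝ) < ν j := by exact_mod_cast hj
    rw [corrMass_sum S (F := fun v y => u v * tentProd (M : ℝ) v y)
      (fun v => (hasCompactSupport_tentProd hM' v).mul_left) hj', Finset.mul_sum]
    refine Finset.sum_congr rfl fun v _ => ?_
    rw [corrMass_const_mul]; ring
  obtain ⟨R, hR⟩ := exists_tentProd_approx hc hf
  have hcut : Filter.Tendsto (fun j => 1 / (ν j : ℝ) * corrMass b (ν j) (ν j) (boxCutoff n R))
      Filter.atTop (nhds (∫ y, boxCutoff n R y)) := by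
    have := hsum 1 le_rfl (intBox n (R + 1)) fun _ => 1
    simp only [one_mul] at this
    exact this
  have hIg : 0 ≤ ∫ y, boxCutoff n R y := integral_nonneg (boxCutoff_nonneg n R)
  set I := ∫ y, boxCutoff n R y with hI
  rw [Metric.tendsto_atTop']
  intro η hη
  -- The error is εI between the integrals and eventually ε(I + 1) between the correlation sums; the
  -- other η/2 pays for the convergence of the hat sum.
  obtain ⟨ε, hε, hεη⟩ : ∃ ε > 0, ε * (2 * I + 1) < η / 2 :=
    ⟨η / 2 / (2 * (2 * I + 1)), by positivity, by field_simp; norm_num⟩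
  obtain ⟨M, hM, B, hB⟩ := hR ε hε
  have hM' : (1 : ℝ) ≤ M := by exact_mod_cast hM
  set h := fun y => ∑ v ∈ intBox n B, f (fun i => v i / M) * tentProd (M : ℝ) v y with hh
  have hhs : HasCompactSupport h :=
    hasCompactSupport_sum _ fun v => (hasCompactSupport_tentProd hM' v).mul_left
  have hhc : Continuous h :=
    continuous_finsetSum _ fun v _ => continuous_const.mul (continuous_tentProd _ v)
  have hgs : HasCompactSupport fun y => ε * boxCutoff n R y :=
    (hasCompactSupport_boxCutoff n R).mul_left
  have hint := integral_sub_le_of_abs_sub_le (h := fun y => ε * boxCutoff n R y) (hc.integrable_of_hasCompactSupport hf)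
    (hhc.integrable_of_hasCompactSupport hhs)
    ((continuous_const.mul (continuous_boxCutoff n R)).integrable_of_hasCompactSupport hgs) hB
  rw [integral_const_mul, ← hI] at hint
  have t1 := Metric.tendsto_nhds.1 (hsum M hM (intBox n B) fun v => f (fun i => v i / M)) (η / 2)
    (by positivity)
  have t2 := hcut.eventually (gt_mem_nhds (show I < I + 1 by linarith))
  obtain ⟨j0, hj0⟩ := Filter.eventually_atTop.1 (hν.and (t1.and t2))
  refine ⟨j0, fun j hj => ?_⟩
  obtain ⟨hj1, hj2, hj3⟩ := hj0 j hj.le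
  have hj' : (0 : ℝ) < ν j := by exact_mod_cast hj1
  have h3 := abs_corrMass_sub_le (b := b) (N := ν j) hf hhs hgs hj' hB
  rw [corrMass_const_mul] at h3
  have h4 : |1 / (ν j : ℝ) * corrMass b (ν j) (ν j) f - 1 / (ν j : ℝ) * corrMass b (ν j) (ν j) h|
      ≤ ε * (I + 1) := by
    rw [← mul_sub, abs_mul, abs_of_pos (by positivity)]
    calc _ ≤ 1 / (ν j : ℝ) * (ε * corrMass b (ν j) (ν j) (boxCutoff n R)) := by gcongr
      _ = ε * (1 / (ν j : ℝ) * corrMass b (ν j) (ν j) (boxCutoff n R)) := by ring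
      _ ≤ ε * (I + 1) := by gcongr
  rw [Real.dist_eq] at hj2 ⊢
  rw [abs_le] at hint h4
  rw [abs_lt] at hj2 ⊢
  constructor <;> linarith [hj2.1, hj2.2]

/-! ### From the sparse subsequence to all N -/

lemma exists_sparse_index {D : ℕ} (hD : 1 ≤ D) : ∃ l : ℕ → ℕ,
    Filter.Tendsto l Filter.atTop Filter.atTop ∧ ∀ N, l N ^ D ≤ N ∧ N ≤ (l N + 1) ^ D := by
  refine ⟨fun N => Nat.findGreatest (fun L => L ^ D ≤ N) N, ?_, fun N => ⟨?_, ?_⟩⟩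
  · rw [Filter.tendsto_atTop]
    intro K
    filter_upwards [Filter.eventually_ge_atTop (K ^ D)] with N hN
    exact Nat.le_findGreatest ((Nat.le_self_pow (by omega) K).trans hN) hN
  · exact Nat.findGreatest_spec (P := fun L => L ^ D ≤ N) (Nat.zero_le N)
      (by rw [zero_pow (by omega)]; exact Nat.zero_le N)
  · by_contra hc
    push Not at hc
    have := Nat.le_findGreatest (P := fun L => L ^ D ≤ N)
      ((Nat.le_self_pow (by omega) _).trans hc.le) hc.le
    omega

lemma tendsto_sparse_ratio (D : ℕ) : Filter.Tendsto
    (fun L : ℕ => ((L ^ D : ℕ) : ℝ) / (((L + 1) ^ D : ℕ) : ℝ)) Filter.atTop (nhds 1) := by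
  have := (tendsto_natCast_div_add_atTop (1 : ℝ)).pow D
  rw [one_pow] at this
  refine this.congr fun L => ?_
  push_cast
  rw [div_pow]

/-- Convergence along a subsequence `L ^ D` implies convergence, for nonnegative functions. -/
lemma tendsto_corrMass_of_sparse_nonneg {n D : ℕ} (hD : 1 ≤ D) {b : ℕ → ℝ}
    (H : ∀ f : (Fin n → ℝ) → ℝ, Continuous f → HasCompactSupport f → Filter.Tendsto
      (fun L : ℕ => 1 / ((L ^ D : ℕ) : ℝ) * corrMass b (L ^ D) ((L ^ D : ℕ) : ℝ) f) Filter.atTop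
      (nhds (∫ y, f y)))
    {f : (Fin n → ℝ) → ℝ} (hc : Continuous f) (hf : HasCompactSupport f) (h0 : ∀ y, 0 ≤ f y) :
    Filter.Tendsto (fun N : ℕ => 1 / (N : ℝ) * corrMass b N N f) Filter.atTop
      (nhds (∫ y, f y)) := by
  obtain ⟨l, hl, hlN⟩ := exists_sparse_index hD
  obtain ⟨R, hR⟩ := exists_scaling_approx hc hf
  set p : ℕ → ℕ := fun N => l N ^ D with hp
  set p' : ℕ → ℕ := fun N => (l N + 1) ^ D with hp'
  have hl1 : Filter.Tendsto (fun N => l N + 1) Filter.atTop Filter.atTop :=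
    (Filter.tendsto_add_atTop_nat 1).comp hl
  have hpos : ∀ᶠ N in Filter.atTop, 1 ≤ p N := by
    filter_upwards [hl.eventually_ge_atTop 1] with N hN
    exact Nat.one_le_pow _ _ hN
  have hpp : Filter.Tendsto (fun N : ℕ => (p N : ℝ) / (p' N : ℝ)) Filter.atTop (nhds 1) :=
    (tendsto_sparse_ratio D).comp hl
  have hr1 : Filter.Tendsto (fun N : ℕ => (p N : ℝ) / (N : ℝ)) Filter.atTop (nhds 1) := by
    refine tendsto_of_tendsto_of_tendsto_of_le_of_le' hpp tendsto_const_nhds ?_ ?_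
    · filter_upwards [Filter.eventually_ge_atTop 1] with N hN
      have : (0 : ℝ) < N := by exact_mod_cast hN
      gcongr
      exact (hlN N).2
    · filter_upwards with N
      exact div_le_one_of_le₀ (by exact_mod_cast (hlN N).1) (Nat.cast_nonneg N)
  have hr2 : Filter.Tendsto (fun N : ℕ => (N : ℝ) / (p' N : ℝ)) Filter.atTop (nhds 1) := by
    refine tendsto_of_tendsto_of_tendsto_of_le_of_le' hpp tendsto_const_nhds ?_ ?_
    · filter_upwards with N
      gcongr
      exact (hlN N).1
    · filter_upwards with N
      exact div_le_one_of_le₀ (by exact_mod_cast (hlN N).2) (Nat.cast_nonneg _)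
  have hr1' : Filter.Tendsto (fun N : ℕ => (N : ℝ) / (p N : ℝ)) Filter.atTop (nhds 1) := by
    simpa using hr1.inv₀ one_ne_zero
  have hr2' : Filter.Tendsto (fun N : ℕ => (p' N : ℝ) / (N : ℝ)) Filter.atTop (nhds 1) := by
    simpa using hr2.inv₀ one_ne_zero
  have hgc := continuous_boxCutoff n R
  have hgs := hasCompactSupport_boxCutoff n R
  have hI : 0 ≤ ∫ y, boxCutoff n R y := integral_nonneg (boxCutoff_nonneg n R)
  have hfr : ∀ r : ℝ, r ≠ 0 → HasCompactSupport fun y : Fin n → ℝ => f (fun i => r * y i) :=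
    fun r hr => hf.comp_homeomorph (Homeomorph.smulOfNeZero r hr)
  -- At count q N, the scale N may be replaced by q N at small cost because their ratio tends to 1.
  -- It is applied with q = p below N and with q = p' above N.
  have key : ∀ ε > 0, ∀ q : ℕ → ℕ, (∀ᶠ N in Filter.atTop, 1 ≤ q N) →
      Filter.Tendsto (fun N : ℕ => (N : ℝ) / (q N : ℝ)) Filter.atTop (nhds 1) →
      ∀ᶠ N : ℕ in Filter.atTop, |corrMass b (q N) N f - corrMass b (q N) (q N) f|
        ≤ ε * corrMass b (q N) (q N) (boxCutoff n R) := by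
    intro ε hε q hq hqr
    obtain ⟨δ, hδ, hδf⟩ := hR ε hε
    filter_upwards [hq, Metric.tendsto_nhds.1 hqr δ hδ, Filter.eventually_ge_atTop 1] with N h1 h2 h3
    have hq0 : (0 : ℝ) < q N := by exact_mod_cast h1
    have hN0 : (0 : ℝ) < N := by exact_mod_cast h3
    rw [corrMass_rescale (s := (N : ℝ)) hq0.ne', ← corrMass_const_mul]
    exact abs_corrMass_sub_le (hfr _ (by positivity)) hf hgs.mul_left hq0
      (hδf _ (by rwa [← Real.dist_eq]))
  have hpos' : ∀ᶠ N in Filter.atTop, 1 ≤ p' N := by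
    filter_upwards with N
    exact Nat.one_le_pow _ _ (Nat.succ_pos _)
  have limp : ∀ F : (Fin n → ℝ) → ℝ, Continuous F → HasCompactSupport F → Filter.Tendsto
      (fun N : ℕ => 1 / (N : ℝ) * corrMass b (p N) (p N) F) Filter.atTop (nhds (∫ y, F y)) := by
    intro F hF hFs
    have := hr1.mul ((H F hF hFs).comp hl)
    rw [one_mul] at this
    refine this.congr' ?_
    filter_upwards [hpos] with N hN
    have : (p N : ℝ) ≠ 0 := by positivity
    show (p N : ℝ) / N * (1 / (p N : ℝ) * corrMass b (p N) (p N) F) = _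
    field_simp
  have limp' : ∀ F : (Fin n → ℝ) → ℝ, Continuous F → HasCompactSupport F → Filter.Tendsto
      (fun N : ℕ => 1 / (N : ℝ) * corrMass b (p' N) (p' N) F) Filter.atTop (nhds (∫ y, F y)) := by
    intro F hF hFs
    have := hr2'.mul ((H F hF hFs).comp hl1)
    rw [one_mul] at this
    refine this.congr' ?_
    filter_upwards [hpos'] with N hN
    have : (p' N : ℝ) ≠ 0 := by positivity
    show (p' N : ℝ) / N * (1 / (p' N : ℝ) * corrMass b (p' N) (p' N) F) = _
    field_simp
  set I := ∫ y, boxCutoff n R y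
  have hεex : ∀ η > 0, ∃ ε > 0, ε * I < η := fun η hη =>
    ⟨η / (I + 1), by positivity, by rw [div_mul_eq_mul_div, div_lt_iff₀ (by positivity)]; nlinarith⟩
  rw [tendsto_order]
  constructor
  -- Lower bound: lower the count from N to p N, then change the scale to p N.
  · intro c hcl
    obtain ⟨ε, hε, hεI⟩ := hεex _ (sub_pos.2 hcl)
    have t := (limp f hc hf).sub ((limp _ hgc hgs).const_mul ε)
    filter_upwards [key ε hε p hpos hr1', t.eventually (lt_mem_nhds (show c < _ by linarith)),
      Filter.eventually_ge_atTop 1] with N h1 h2 h3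
    have hN0 : (0 : ℝ) < N := by exact_mod_cast h3
    refine h2.trans_le ?_
    have hm : corrMass b (p N) N f ≤ corrMass b N N f := corrMass_mono_count (hlN N).1 h0
    have := (abs_le.1 h1).1
    calc _ = 1 / (N : ℝ) * (corrMass b (p N) (p N) f
          - ε * corrMass b (p N) (p N) (boxCutoff n R)) := by ring
      _ ≤ _ := by gcongr; linarith
  -- Upper bound: raise the count from N to p' N, then change the scale to p' N.
  · intro c hcl
    obtain ⟨ε, hε, hεI⟩ := hεex _ (sub_pos.2 hcl)
    have t := (limp' f hc hf).add ((limp' _ hgc hgs).const_mul ε)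
    filter_upwards [key ε hε p' hpos' hr2, t.eventually (gt_mem_nhds (show _ < c by linarith)),
      Filter.eventually_ge_atTop 1] with N h1 h2 h3
    have hN0 : (0 : ℝ) < N := by exact_mod_cast h3
    refine lt_of_le_of_lt ?_ h2
    have hm : corrMass b N N f ≤ corrMass b (p' N) N f := corrMass_mono_count (hlN N).2 h0
    have := (abs_le.1 h1).2
    calc _ ≤ 1 / (N : ℝ) * (corrMass b (p' N) (p' N) f
          + ε * corrMass b (p' N) (p' N) (boxCutoff n R)) := by gcongr; linarith
      _ = _ := by ring

/-- The sandwich needs monotonicity in the count, hence f ≥ 0; positive and negative parts are still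
continuous with compact support, although no longer smooth. -/
theorem tendsto_corrMass_of_sparse {n D : ℕ} (hD : 1 ≤ D) {b : ℕ → ℝ}
    (H : ∀ f : (Fin n → ℝ) → ℝ, Continuous f → HasCompactSupport f → Filter.Tendsto
      (fun L : ℕ => 1 / ((L ^ D : ℕ) : ℝ) * corrMass b (L ^ D) ((L ^ D : ℕ) : ℝ) f) Filter.atTop
      (nhds (∫ y, f y)))
    {f : (Fin n → ℝ) → ℝ} (hc : Continuous f) (hf : HasCompactSupport f) :
    Filter.Tendsto (fun N : ℕ => 1 / (N : ℝ) * corrMass b N N f) Filter.atTop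
      (nhds (∫ y, f y)) := by
  have hs1 : HasCompactSupport fun y => max (f y) 0 := hf.comp_left (g := fun t => max t 0) (by simp)
  have hs2 : HasCompactSupport fun y => max (-f y) 0 :=
    hf.comp_left (g := fun t => max (-t) 0) (by simp)
  have hc1 : Continuous fun y => max (f y) 0 := hc.max continuous_const
  have hc2 : Continuous fun y => max (-f y) 0 := hc.neg.max continuous_const
  have h1 := tendsto_corrMass_of_sparse_nonneg hD H hc1 hs1 fun y => le_max_right _ _
  have h2 := tendsto_corrMass_of_sparse_nonneg hD H hc2 hs2 fun y => le_max_right _ _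
  have hsplit : ∀ y, max (f y) 0 = f y + max (-f y) 0 := fun y => by
    rcases le_total (f y) 0 with h | h
    · rw [max_eq_right h, max_eq_left (by linarith)]; ring
    · rw [max_eq_left h, max_eq_right (by linarith)]; ring
  have e : ∫ y, f y = (∫ y, max (f y) 0) - ∫ y, max (-f y) 0 := by
    simp only [hsplit]
    rw [integral_add (hc.integrable_of_hasCompactSupport hf)
      (hc2.integrable_of_hasCompactSupport hs2)]
    ring
  rw [e]
  refine (h1.sub h2).congr' ?_
  filter_upwards [Filter.eventually_ge_atTop 1] with N hN
  have hN0 : (0 : ℝ) < N := by exact_mod_cast hN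
  simp only [hsplit]
  rw [corrMass_add hf hs2 hN0]
  ring

/-! ### Conclusion -/

theorem theorem1p1 (a : ℕ → ℝ) (hpos : ∀ n : ℕ, 1 ≤ n → 0 < a n) (hlac : IsLacunary a) :
    ∀ᵐ α : ℝ ∂MeasureTheory.volume, ∀ k : ℕ, 2 ≤ k →
      HasPoissonianCorrelation k (fun n => α * a n) := by
  -- Only countably many triples (n, M, v) occur, so one null set serves every k and every f.
  have hae : ∀ᵐ α : ℝ, ∀ (n M : ℕ) (_ : 1 ≤ M) (v : Fin n → ℤ),
      Filter.Tendsto (fun L : ℕ => 1 / ((L ^ sparseExp n : ℕ) : ℝ) *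
      ∑ x ∈ distinctTuples (n + 1) (L ^ sparseExp n), tupleWeight a (L ^ sparseExp n) M v α x)
      Filter.atTop (nhds ((tentMass / M) ^ n)) := by
    simp only [ae_all_iff]
    exact fun n M hM v => ae_tendsto_sparse_tupleWeight hlac hpos v hM
  filter_upwards [hae] with α hα k hk
  obtain ⟨n, rfl⟩ : ∃ n, k = n + 1 := ⟨k - 1, by omega⟩
  have hD : 1 ≤ sparseExp n := by unfold sparseExp; omega
  have htent : ∀ M : ℕ, 1 ≤ M → ∀ v : Fin n → ℤ, Filter.Tendsto
      (fun L : ℕ => 1 / ((L ^ sparseExp n : ℕ) : ℝ) * corrMass (fun j => α * a j)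
        (L ^ sparseExp n) ((L ^ sparseExp n : ℕ) : ℝ) (tentProd (M : ℝ) v)) Filter.atTop
      (nhds (∫ y, tentProd (M : ℝ) v y)) := by
    intro M hM v
    rw [integral_tentProd (by exact_mod_cast hM)]
    refine (hα n M hM v).congr' ?_
    filter_upwards [Filter.eventually_ge_atTop 2] with L hL
    rw [corrMass_tentProd (hL.trans (Nat.le_self_pow (by omega) L)) hM]
  have hlim : ∀ f : (Fin n → ℝ) → ℝ, ContDiff ℝ ∞ f → HasCompactSupport f →
      Filter.Tendsto (fun N : ℕ => correlationSum (n + 1) f (fun j => α * a j) N) Filter.atTop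
        (nhds (∫ y : Fin n → ℝ, f y)) := by
    intro f hfc hfs
    have hν : ∀ᶠ L : ℕ in Filter.atTop, 1 ≤ L ^ sparseExp n := by
      filter_upwards [Filter.eventually_ge_atTop 1] with L hL
      exact Nat.one_le_pow _ _ hL
    have := tendsto_corrMass_of_sparse hD (fun g hg hgs =>
      tendsto_corrMass_of_tentProd hν htent hg hgs) hfc.continuous hfs
    refine this.congr' ?_
    filter_upwards [Filter.eventually_ge_atTop 1] with N hN
    exact (correlationSum_eq hfs hN).symm
  -- `Fin (n + 1 - 1)` and `Fin n` agree definitionally.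
  exact hlim
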